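/- For every integer $\Delta\ge 0$ there exist $\beta(\Delta)>0$ and $\delta=\delta(\Delta)>0$ such that the following holds. Let $n\ge 1$, let $G=([n],E)$ be any graph all of whose degrees are at most $\Delta$, let $\beta_{ij}\in\mathbb{R}$ for $\{i,j\}\in E$ satisfy $|\beta_{ij}|<\beta(\Delta)$ (this includes the ferromagnetic models $0\le\beta_{ij}<\beta(\Delta)$), and let $B\in\mathbb{R}$. Consider the Ising model on $\{-1,1\}^n$ with Hamiltonian $$H(\sigma)=-\sum_{\{i,j\}\in E}\beta_{ij}\sigma_i\sigma_j-B\sum_{i=1}^n\sigma_i ,$$ its Gibbs distribution $\pi(\sigma)\propto e^{-H(\sigma)}$, and the transition matrix $P$ of its Glauber dynamics: in state $\sigma$ pick $i\in[n]$ uniformly at random; with probability $1/2$ do nothing; otherwise, with $\sigma'$ the configuration obtained from $\sigma$ by flipping the spin at $i$, move to $\sigma'$ with probability $e^{-H(\sigma')}/(e^{-H(\sigma)}+e^{-H(\sigma')})$ and stay at $\sigma$ with the remaining probability. For $f:\{-1,1\}^n\to\{-1,1\}$ let $$\operatorname{NS}_t(f)=\Pr_{x\sim\pi,\ y\sim P^t(x,\cdot)}[f(x)\ne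 f(y)].$$ Then for all $w\in\mathbb{R}^n$, with $f(x)=\operatorname{sign}\bigl(\sum_{i=1}^n w_ix_i\bigr)$ (where $\operatorname{sign}(0)=1$), and all integers $t\ge n$, $$1-2\operatorname{NS}_t(f)\ \ge\ \delta^{\,t/n}.$$ -/

import Mathlib

open scoped BigOperators

namespace IsingGlauber

noncomputable section

/-- Spin configurations on the nodes `Fin n`: a spin is an element of `ℤˣ = {1, -1}`. -/
abbrev Config (n : ℕ) : Type := Fin n → ℤˣ

/-- The real number `1` or `-1` attached to a spin. -/
def spin (s : ℤˣ) : ℝ := ((s : ℤ) : ℝ)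

/-- The product `σ_i σ_j` of the two spins at the ends of an unordered pair `{i, j}`. -/
def edgeSpin {n : ℕ} (σ : Config n) (e : Sym2 (Fin n)) : ℝ :=
  Sym2.lift ⟨fun i j => spin (σ i) * spin (σ j), fun i j => mul_comm (spin (σ i)) (spin (σ j))⟩ e

/-- The Hamiltonian with interaction `J e` on each edge `e` of `G` and external field `B`:
`H(σ) = - ∑_{{i,j} ∈ E} J_{ij} σ_i σ_j - B ∑_i σ_i`. -/
def hamiltonian {n : ℕ} (G : SimpleGraph (Fin n)) [DecidableRel G.Adj]
    (J : Sym2 (Fin n) → ℝ) (B : ℝ) (σ : Config n) : ℝ :=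
  -(∑ e ∈ G.edgeFinset, J e * edgeSpin σ e) - B * ∑ i, spin (σ i)

/-- The Gibbs distribution `π(σ) = exp(-H(σ)) / Z`. -/
def gibbs {n : ℕ} (G : SimpleGraph (Fin n)) [DecidableRel G.Adj]
    (J : Sym2 (Fin n) → ℝ) (B : ℝ) (σ : Config n) : ℝ :=
  Real.exp (-hamiltonian G J B σ) / ∑ τ : Config n, Real.exp (-hamiltonian G J B τ)

/-- The configuration obtained from `σ` by flipping the spin at node `i`. -/
def flip {n : ℕ} (σ : Config n) (i : Fin n) : Config n :=
  Function.update σ i (-σ i)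

/-- The probability of accepting the flip at the chosen node `i`:
`exp(-H(σ')) / (exp(-H(σ)) + exp(-H(σ')))`, where `σ'` is `σ` flipped at `i`. -/
def flipProb {n : ℕ} (G : SimpleGraph (Fin n)) [DecidableRel G.Adj]
    (J : Sym2 (Fin n) → ℝ) (B : ℝ) (σ : Config n) (i : Fin n) : ℝ :=
  Real.exp (-hamiltonian G J B (flip σ i)) /
    (Real.exp (-hamiltonian G J B σ) + Real.exp (-hamiltonian G J B (flip σ i)))

/-- The transition matrix of the (lazy) Glauber dynamics: choose a node `i` uniformly; with
probability `1/2` do nothing; otherwise flip the spin at `i` with probability `flipProb`, and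
leave the configuration unchanged with the remaining probability. -/
def glauber {n : ℕ} (G : SimpleGraph (Fin n)) [DecidableRel G.Adj]
    (J : Sym2 (Fin n) → ℝ) (B : ℝ) : Matrix (Config n) (Config n) ℝ :=
  fun σ τ => ∑ i : Fin n, (1 / (n : ℝ)) *
    ((1 / 2) * (if τ = σ then 1 else 0) +
      (1 / 2) * (flipProb G J B σ i * (if τ = flip σ i then 1 else 0) +
        (1 - flipProb G J B σ i) * (if τ = σ then 1 else 0)))

/-- Noise sensitivity `NS_t(f) = Pr[f(x) ≠ f(y)]`, where `x` is drawn from the distribution `π`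
and `y` from `P^t(x, ·)`. -/
def noiseSensitivity {X : Type*} [Fintype X] [DecidableEq X] (π : X → ℝ) (P : Matrix X X ℝ)
    (t : ℕ) (f : X → ℤˣ) : ℝ :=
  ∑ x, ∑ y, π x * (P ^ t) x y * (if f x ≠ f y then 1 else 0)

/-- The halfspace `x ↦ sign (∑ i, w_i x_i)`, with the convention `sign 0 = 1`. -/
def halfspace {n : ℕ} (w : Fin n → ℝ) (x : Config n) : ℤˣ :=
  if 0 ≤ ∑ i, w i * spin (x i) then 1 else -1

end

end IsingGlauber

/-! In L²(π) the quantity 1 - 2 NS_t(f) is ⟨f, P^t f⟩, and P = 1 - (1/2n) ∑ D_i, where D_i = 1 - E_i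
and E_i averages the spin at i given the others. The D_i are orthogonal projections and commute for
non-adjacent sites; P is self-adjoint with 0 ≤ P ≤ 1. If ⟨f, P^s f⟩ ≥ 1/2 for some s of order n,
Jensen's inequality for the spectral measure of f gives the exponential bound (`rpow_le_inner_pow`).

To find such an s, f is approximated by a g with energy ∑ ‖D_i g‖² bounded in terms of Δ only; then
s steps of P cost g at most s/(2n) times its energy. The function g comes from a sweep: colour G
with Δ + 1 colours and apply ∏ (1 - κ D_i), κ = 1/m, to one colour class after another. The energy
stays bounded because each site sees at most Δ neighbours (`energy_sweep_le`).

That f moves little is Peres' argument for halfspaces (`inner_sub_dampProd_signForm_le`). Split a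
colour class at random into m blocks and resample one block. Let S_j be the sign of the change of
the linear form when block j is resampled. Exchanging old and new spins of block j preserves the
joint law, reverses S_j and fixes the other S_k. So the S_j are orthogonal, ∑ S_j has L² norm at
most √m, and the average cost per block is at most 2/√m. -/

namespace IsingGlauber

noncomputable section

/-! ### Products of damped commuting projections in an inner product space. -/

section Projections

open scoped InnerProductSpace

variable {E : Type*} [NormedAddCommGroup E] [InnerProductSpace ℝ E] {ι : Type*}

theorem inner_proj_self {D : Module.End ℝ E} (hD : D.IsSymmetricProjection) (v : E) :
    ⟪D v, v⟫_ℝ = ‖D v‖ ^ 2 := by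
  have h : D (D v) = D v := by
    rw [← Module.End.mul_apply, hD.isIdempotentElem.eq]
  rw [← real_inner_self_eq_norm_sq, hD.isSymmetric (D v) v |>.symm, h]

theorem norm_sub_smul_proj_sq {D : Module.End ℝ E} (hD : D.IsSymmetricProjection)
    (κ : ℝ) (v : E) :
    ‖v - κ • D v‖ ^ 2 = ‖v‖ ^ 2 - (2 * κ - κ ^ 2) * ‖D v‖ ^ 2 := by
  rw [norm_sub_sq_real, inner_smul_right, real_inner_comm, inner_proj_self hD, norm_smul, mul_pow,
    Real.norm_eq_abs, sq_abs]
  ring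

theorem norm_sub_smul_proj_le {D : Module.End ℝ E} (hD : D.IsSymmetricProjection)
    {κ : ℝ} (h0 : 0 ≤ κ) (h1 : κ ≤ 1) (v : E) : ‖v - κ • D v‖ ≤ ‖v‖ := by
  refine le_of_sq_le_sq ?_ (norm_nonneg _)
  rw [norm_sub_smul_proj_sq hD]
  have : 0 ≤ (2 * κ - κ ^ 2) * ‖D v‖ ^ 2 := mul_nonneg (by nlinarith) (sq_nonneg _)
  linarith

theorem norm_proj_le {D : Module.End ℝ E} (hD : D.IsSymmetricProjection) (v : E) :
    ‖D v‖ ≤ ‖v‖ := by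
  refine le_of_sq_le_sq ?_ (norm_nonneg _)
  have h := norm_sub_smul_proj_sq hD 1 v
  have := sq_nonneg ‖v - (1 : ℝ) • D v‖
  linarith

theorem commute_apply {A B : Module.End ℝ E} (h : Commute A B) (v : E) : A (B v) = B (A v) := by
  rw [← Module.End.mul_apply, h.eq, Module.End.mul_apply]

/-- The product over a list of the partial resampling operators `1 - κ D_i`. -/
def dampProd (κ : ℝ) (D : ι → Module.End ℝ E) (l : List ι) : Module.End ℝ E :=
  (l.map fun i => 1 - κ • D i).prod

theorem dampProd_cons (κ : ℝ) (D : ι → Module.End ℝ E) (j : ι) (l : List ι) (v : E) :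
    dampProd κ D (j :: l) v = dampProd κ D l v - κ • D j (dampProd κ D l v) := by
  simp [dampProd]

theorem dampProd_append (κ : ℝ) (D : ι → Module.End ℝ E) (l l' : List ι) :
    dampProd κ D (l ++ l') = dampProd κ D l * dampProd κ D l' := by
  simp [dampProd]

theorem dampProd_commute {κ : ℝ} {D : ι → Module.End ℝ E} {A : Module.End ℝ E} {l : List ι}
    (h : ∀ j ∈ l, Commute A (D j)) : Commute A (dampProd κ D l) := by
  refine Commute.list_prod_right _ _ fun B hB => ?_
  obtain ⟨j, hj, rfl⟩ := List.mem_map.1 hB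
  exact (Commute.one_right _).sub_right ((h j hj).smul_right κ)

theorem norm_dampProd_le {D : ι → Module.End ℝ E} (hD : ∀ i, (D i).IsSymmetricProjection)
    {κ : ℝ} (h0 : 0 ≤ κ) (h1 : κ ≤ 1) (l : List ι) (v : E) : ‖dampProd κ D l v‖ ≤ ‖v‖ := by
  induction l with
  | nil => simp [dampProd]
  | cons j l ih =>
    rw [dampProd_cons]
    exact (norm_sub_smul_proj_le (hD j) h0 h1 _).trans ih

/-- Partial resampling on commuting sites produces a function of bounded energy on these sites. -/
theorem energy_dampProd_le {D : ι → Module.End ℝ E} (hD : ∀ i, (D i).IsSymmetricProjection)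
    {κ : ℝ} (h0 : 0 ≤ κ) (h1 : κ ≤ 1) {l : List ι}
    (hc : l.Pairwise fun i j => Commute (D i) (D j)) (v : E) :
    κ * (l.map fun i => ‖D i (dampProd κ D l v)‖ ^ 2).sum ≤ ‖v‖ ^ 2 - ‖dampProd κ D l v‖ ^ 2 := by
  induction l with
  | nil => simp [dampProd]
  | cons j l ih =>
    rw [List.pairwise_cons] at hc
    have ih := ih hc.2
    simp only [dampProd_cons]
    set u := dampProd κ D l v
    -- The new factor is a contraction commuting with D_i, so energies already controlled only
    -- decrease; the drop of ‖u‖², at least κ‖D_j u‖², pays for site j.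
    have hle : (l.map fun i => ‖D i (u - κ • D j u)‖ ^ 2).sum ≤
        (l.map fun i => ‖D i u‖ ^ 2).sum := by
      refine List.sum_le_sum fun i hi => ?_
      have e : D i (u - κ • D j u) = D i u - κ • D j (D i u) := by
        rw [map_sub, map_smul, commute_apply (hc.1 i hi)]
      rw [e]
      exact pow_le_pow_left₀ (norm_nonneg _) (norm_sub_smul_proj_le (hD j) h0 h1 _) 2
    have hj : ‖D j (u - κ • D j u)‖ ^ 2 ≤ ‖D j u‖ ^ 2 := by
      rw [map_sub, map_smul]
      exact pow_le_pow_left₀ (norm_nonneg _) (norm_sub_smul_proj_le (hD j) h0 h1 _) 2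
    rw [List.map_cons, List.sum_cons, norm_sub_smul_proj_sq (hD j)]
    have hk : κ ^ 2 ≤ κ := by nlinarith
    nlinarith [mul_le_mul_of_nonneg_left hle h0, mul_le_mul_of_nonneg_left hj h0,
      mul_le_mul_of_nonneg_right hk (sq_nonneg ‖D j u‖)]

/-- Undoing a few partial resampling steps changes a vector by at most its energy there. -/
theorem norm_sub_le_of_dampProd_eq {D : ι → Module.End ℝ E}
    (hD : ∀ i, (D i).IsSymmetricProjection) {κ : ℝ} (h0 : 0 ≤ κ) (h1 : κ ≤ 1 / 2) {l : List ι}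
    (hc : l.Pairwise fun i j => Commute (D i) (D j)) (u : E) :
    ‖u - dampProd κ D l u‖ ≤
      2 ^ l.length * (l.map fun i => ‖D i (dampProd κ D l u)‖).sum := by
  induction l with
  | nil => simp [dampProd]
  | cons j l ih =>
    rw [List.pairwise_cons] at hc
    have ih := ih hc.2
    simp only [dampProd_cons]
    set v := dampProd κ D l u
    -- For κ ≤ 1/2 each factor is invertible at the cost of a factor 2, whence 2 ^ l.length.
    have hback : ∀ w : E, ‖w‖ ≤ 2 * ‖w - κ • D j w‖ := fun w => by
      have := norm_sub_norm_le w (κ • D j w)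
      rw [norm_smul, Real.norm_of_nonneg h0] at this
      nlinarith [norm_proj_le (hD j) w, norm_nonneg (D j w), norm_nonneg w]
    have hle : (l.map fun i => ‖D i v‖).sum ≤
        2 * (l.map fun i => ‖D i (v - κ • D j v)‖).sum := by
      rw [← List.sum_map_mul_left]
      refine List.sum_le_sum fun i hi => ?_
      have e : D i (v - κ • D j v) = D i v - κ • D j (D i v) := by
        rw [map_sub, map_smul, commute_apply (hc.1 i hi)]
      rw [e]
      exact hback _
    have hj : ‖D j v‖ ≤ 2 * ‖D j (v - κ • D j v)‖ := by
      rw [map_sub, map_smul]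
      exact hback _
    have htri : ‖u - (v - κ • D j v)‖ ≤ ‖u - v‖ + ‖D j v‖ := by
      have : u - (v - κ • D j v) = (u - v) + κ • D j v := by abel
      rw [this]
      refine (norm_add_le _ _).trans (add_le_add le_rfl ?_)
      rw [norm_smul, Real.norm_of_nonneg h0]
      nlinarith [norm_nonneg (D j v)]
    rw [List.map_cons, List.sum_cons, List.length_cons, pow_succ]
    have h2 : (1 : ℝ) ≤ 2 ^ l.length := one_le_pow₀ (by norm_num)
    have := mul_le_mul_of_nonneg_left hle (zero_le_one.trans h2)
    have := mul_le_mul_of_nonneg_right h2 (norm_nonneg (D j (v - κ • D j v)))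
    nlinarith

/-- Partial resampling on commuting sites, seen from a site that commutes with all of these but the
ones in `p`. -/
theorem norm_proj_dampProd_le {D : ι → Module.End ℝ E}
    (hD : ∀ i, (D i).IsSymmetricProjection) {κ : ℝ} (h0 : 0 ≤ κ) (h1 : κ ≤ 1 / 2) {l : List ι}
    (hc : l.Pairwise fun i j => Commute (D i) (D j)) (i : ι) (p : ι → Bool)
    (hp : ∀ j ∈ l, p j = false → Commute (D i) (D j)) (v : E) :
    ‖D i (dampProd κ D l v)‖ ≤ ‖D i v‖ +
      2 ^ (l.filter p).length *
        ((l.filter p).map fun j => ‖D j (dampProd κ D l v)‖).sum := by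
  -- The sites commuting with D_i are applied first, and D_i passes through them; only those in `p`
  -- remain to be undone.
  have hperm : dampProd κ D l =
      dampProd κ D (l.filter p) * dampProd κ D (l.filter fun j => !p j) := by
    rw [← dampProd_append]
    refine ((List.filter_append_perm p l).symm.map _).prod_eq' ?_
    rw [List.pairwise_map]
    exact hc.imp fun h => (Commute.one_left _).sub_left
      (((Commute.one_right _).sub_right (h.smul_right κ)).smul_left κ)
  set u := dampProd κ D (l.filter fun j => !p j) v with hu
  have hQ : dampProd κ D l v = dampProd κ D (l.filter p) u := by
    rw [hperm, Module.End.mul_apply]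
  have hDu : ‖D i u‖ ≤ ‖D i v‖ := by
    have hcomm : Commute (D i) (dampProd κ D (l.filter fun j => !p j)) :=
      dampProd_commute fun j hj => by
        rw [List.mem_filter] at hj
        exact hp j hj.1 (by simpa using hj.2)
    rw [hu, commute_apply hcomm]
    exact norm_dampProd_le hD h0 (h1.trans (by norm_num)) _ _
  have hdiff := norm_sub_le_of_dampProd_eq hD h0 h1 (hc.filter p) u
  rw [← hQ] at hdiff
  set z := dampProd κ D l v
  have : D i z = D i u - D i (u - z) := by rw [map_sub]; abel
  rw [this]
  exact (norm_sub_le _ _).trans (add_le_add hDu ((norm_proj_le (hD i) _).trans hdiff))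

end Projections

/-! ### Sweeping through the colour classes: closeness and bounded energy. -/

section Sweep

open scoped InnerProductSpace

variable {E : Type*} [NormedAddCommGroup E] [InnerProductSpace ℝ E]

/-- The list of the nodes of colour `c`. -/
def colourClass {n : ℕ} (χ : Fin n → ℕ) (c : ℕ) : List (Fin n) :=
  (List.finRange n).filter fun i => χ i = c

theorem mem_colourClass {n : ℕ} {χ : Fin n → ℕ} {c : ℕ} {i : Fin n} :
    i ∈ colourClass χ c ↔ χ i = c := by
  simp [colourClass]

theorem nodup_colourClass {n : ℕ} (χ : Fin n → ℕ) (c : ℕ) : (colourClass χ c).Nodup :=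
  (List.nodup_finRange n).filter _

theorem sum_map_filter_colourClass {n : ℕ} (χ : Fin n → ℕ) (c : ℕ) (p : Fin n → Bool)
    (e : Fin n → ℝ) :
    (((colourClass χ c).filter p).map e).sum =
      ∑ j ∈ Finset.univ.filter (fun j => χ j = c ∧ p j = true), e j := by
  rw [← List.sum_toFinset _ ((nodup_colourClass χ c).filter p)]
  refine Finset.sum_congr ?_ fun _ _ => rfl
  ext j
  simp [mem_colourClass]

/-- The vector obtained from `v` by partial resampling of the first `k` colour classes in turn. -/
def sweep {n : ℕ} (κ : ℝ) (D : Fin n → Module.End ℝ E) (χ : Fin n → ℕ) (v : E) : ℕ → E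
  | 0 => v
  | k + 1 => dampProd κ D (colourClass χ k) (sweep κ D χ v k)

variable {n : ℕ} {D : Fin n → Module.End ℝ E} {κ : ℝ} {χ : Fin n → ℕ}

theorem norm_sweep_le (hD : ∀ i, (D i).IsSymmetricProjection) (h0 : 0 ≤ κ) (h1 : κ ≤ 1 / 2)
    (v : E) (k : ℕ) : ‖sweep κ D χ v k‖ ≤ ‖v‖ := by
  induction k with
  | zero => exact le_rfl
  | succ k ih => exact (norm_dampProd_le hD h0 (h1.trans (by norm_num)) _ _).trans ih

/-- Each class acts as a contraction, so errors only add up; stability of the original vector under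
each class separately is enough. -/
theorem norm_sub_sweep_le (hD : ∀ i, (D i).IsSymmetricProjection) (h0 : 0 ≤ κ) (h1 : κ ≤ 1 / 2)
    (v : E) (ε : ℝ) (hv : ∀ c, ‖v - dampProd κ D (colourClass χ c) v‖ ≤ ε) (k : ℕ) :
    ‖v - sweep κ D χ v k‖ ≤ k * ε := by
  induction k with
  | zero => simp [sweep]
  | succ k ih =>
    have e : v - sweep κ D χ v (k + 1) = (v - dampProd κ D (colourClass χ k) v) +
        dampProd κ D (colourClass χ k) (v - sweep κ D χ v k) := by
      rw [map_sub, sweep]; abel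
    rw [e]
    have := norm_dampProd_le hD h0 (h1.trans (by norm_num)) (colourClass χ k)
      (v - sweep κ D χ v k)
    have := norm_add_le (v - dampProd κ D (colourClass χ k) v)
      (dampProd κ D (colourClass χ k) (v - sweep κ D χ v k))
    have := hv k
    push_cast
    linarith

/-- The energy of a sweep through the colour classes is bounded independently of the number of
nodes. -/
theorem energy_sweep_le (G : SimpleGraph (Fin n)) [DecidableRel G.Adj] {Δ : ℕ}
    (hG : ∀ i, G.degree i ≤ Δ) (hχ : ∀ i j, G.Adj i j → χ i ≠ χ j)
    (hD : ∀ i, (D i).IsSymmetricProjection)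
    (hc : ∀ i j, ¬ G.Adj i j → Commute (D i) (D j))
    (h0 : 0 < κ) (h1 : κ ≤ 1 / 2) (v : E) (hv : ‖v‖ = 1) (k : ℕ) :
    ∑ i ∈ Finset.univ.filter (fun i => χ i < k), ‖D i (sweep κ D χ v k)‖ ^ 2 ≤
      (2 ^ k - 1) * ((1 + 2 * 4 ^ Δ * Δ ^ 2) / κ) := by
  have hpair : ∀ c, (colourClass χ c).Pairwise fun i j => Commute (D i) (D j) := fun c =>
    List.pairwise_of_forall_mem_list fun i hi j hj => hc i j fun hij => hχ i j hij <| by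
      rw [mem_colourClass.1 hi, mem_colourClass.1 hj]
  induction k with
  | zero => simp
  | succ k ih =>
    set g := sweep κ D χ v k with hg
    have hg' : sweep κ D χ v (k + 1) = dampProd κ D (colourClass χ k) g := rfl
    set g' := sweep κ D χ v (k + 1)
    set M : ℝ := ∑ j ∈ Finset.univ.filter (fun j => χ j = k), ‖D j g'‖ ^ 2 with hM
    have hM0 : 0 ≤ M := Finset.sum_nonneg fun _ _ => sq_nonneg _
    have hMκ : M ≤ 1 / κ := by
      have h := energy_dampProd_le hD h0.le (h1.trans (by norm_num)) (hpair k) g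
      rw [← hg'] at h
      have e := sum_map_filter_colourClass χ k (fun _ => true) fun i => ‖D i g'‖ ^ 2
      simp only [List.filter_true, and_true] at e
      rw [e] at h
      rw [le_div_iff₀ h0, mul_comm]
      have h2 := norm_sweep_le (χ := χ) hD h0.le h1 v k
      rw [hv, ← hg] at h2
      nlinarith [sq_nonneg ‖g'‖, norm_nonneg g]
    have hsite : ∀ i, ‖D i g'‖ ^ 2 ≤ 2 * ‖D i g‖ ^ 2 + 2 * 4 ^ Δ * Δ *
        ∑ j ∈ Finset.univ.filter (fun j => χ j = k ∧ G.Adj i j), ‖D j g'‖ ^ 2 := by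
      intro i
      have h := norm_proj_dampProd_le hD h0.le h1 (hpair k) i (fun j => decide (G.Adj i j))
        (fun j _ hj => hc i j (by simpa using hj)) g
      rw [← hg', sum_map_filter_colourClass] at h
      have hcard : (Finset.univ.filter fun j => χ j = k ∧ G.Adj i j).card ≤ Δ := by
        refine le_trans (Finset.card_le_card ?_) (hG i)
        intro j hj
        simpa using (Finset.mem_filter.1 hj).2.2
      have hlen : ((colourClass χ k).filter fun j => decide (G.Adj i j)).length ≤ Δ := by
        rw [← List.toFinset_card_of_nodup ((nodup_colourClass χ k).filter _)]
        refine le_trans (Finset.card_le_card ?_) (hG i)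
        intro j hj
        simpa using (by simpa using hj : j ∈ colourClass χ k ∧ G.Adj i j).2
      simp only [decide_eq_true_eq] at h
      set T := Finset.univ.filter fun j => χ j = k ∧ G.Adj i j
      set s := ∑ j ∈ T, ‖D j g'‖
      have hs0 : 0 ≤ s := Finset.sum_nonneg fun _ _ => norm_nonneg _
      have hs : s ^ 2 ≤ Δ * ∑ j ∈ T, ‖D j g'‖ ^ 2 :=
        sq_sum_le_card_mul_sum_sq.trans (mul_le_mul_of_nonneg_right (by exact_mod_cast hcard)
          (Finset.sum_nonneg fun _ _ => sq_nonneg _))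
      have h' : ‖D i g'‖ ≤ ‖D i g‖ + 2 ^ Δ * s :=
        h.trans (add_le_add le_rfl (mul_le_mul_of_nonneg_right
          (pow_le_pow_right₀ (by norm_num) hlen) hs0))
      have h4 : (4 : ℝ) ^ Δ = (2 ^ Δ) ^ 2 := by rw [← pow_mul, mul_comm, pow_mul]; norm_num
      calc ‖D i g'‖ ^ 2 ≤ (‖D i g‖ + 2 ^ Δ * s) ^ 2 :=
            pow_le_pow_left₀ (norm_nonneg _) h' 2
        _ ≤ 2 * ‖D i g‖ ^ 2 + 2 * 4 ^ Δ * s ^ 2 := by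
            rw [h4]; nlinarith [sq_nonneg (‖D i g‖ - 2 ^ Δ * s)]
        _ ≤ _ := by
            have := mul_le_mul_of_nonneg_left hs (by positivity : (0 : ℝ) ≤ 2 * 4 ^ Δ)
            linarith
    -- Double counting: each site of colour k is charged by its at most Δ neighbours.
    have hdouble : ∑ i ∈ Finset.univ.filter (fun i => χ i < k),
        ∑ j ∈ Finset.univ.filter (fun j => χ j = k ∧ G.Adj i j), ‖D j g'‖ ^ 2 ≤ Δ * M := by
      calc _ ≤ ∑ i, ∑ j ∈ Finset.univ.filter (fun j => χ j = k ∧ G.Adj i j), ‖D j g'‖ ^ 2 :=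
            Finset.sum_le_sum_of_subset_of_nonneg (Finset.filter_subset _ _)
              fun _ _ _ => Finset.sum_nonneg fun _ _ => sq_nonneg _
        _ = ∑ j ∈ Finset.univ.filter (fun j => χ j = k), G.degree j * ‖D j g'‖ ^ 2 := by
            rw [Finset.sum_comm' (t' := Finset.univ.filter fun j => χ j = k)
              (s' := fun j => G.neighborFinset j)]
            · simp
            · intro i j
              simp [G.adj_comm, and_comm]
        _ ≤ Δ * M := by
            rw [hM, Finset.mul_sum]
            exact Finset.sum_le_sum fun j _ =>
              mul_le_mul_of_nonneg_right (by exact_mod_cast hG j) (sq_nonneg _)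
    have hsplit : Finset.univ.filter (fun i => χ i < k + 1) =
        Finset.univ.filter (fun i => χ i < k) ∪ Finset.univ.filter (fun i => χ i = k) := by
      ext i; simp; omega
    have hdisj : Disjoint (Finset.univ.filter fun i => χ i < k)
        (Finset.univ.filter fun i => χ i = k) := by
      rw [Finset.disjoint_filter]; intro i _; omega
    rw [hsplit, Finset.sum_union hdisj, ← hM]
    have hsum := Finset.sum_le_sum fun i (_ : i ∈ Finset.univ.filter fun i => χ i < k) => hsite i
    rw [Finset.sum_add_distrib, ← Finset.mul_sum, ← Finset.mul_sum] at hsum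
    have hB : (0 : ℝ) ≤ 2 * 4 ^ Δ * Δ := by positivity
    have := mul_le_mul_of_nonneg_left hdouble hB
    -- The recursion is e_{k+1} ≤ 2 e_k + C with e_0 = 0, solved by (2^k - 1) C.
    have h5 : (1 + 2 * 4 ^ Δ * Δ ^ 2) * M ≤ (1 + 2 * 4 ^ Δ * Δ ^ 2) / κ := by
      rw [div_eq_mul_one_div]
      exact mul_le_mul_of_nonneg_left hMκ (by positivity)
    rw [pow_succ]
    nlinarith

end Sweep

/-! ### Moments of a self-adjoint operator between 0 and 1. -/

section Semigroup

open scoped InnerProductSpace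

variable {E : Type*} [NormedAddCommGroup E] [InnerProductSpace ℝ E] {P : Module.End ℝ E}

theorem inner_pow_add (hs : P.IsSymmetric) (j k : ℕ) (u v : E) :
    ⟪u, (P ^ (j + k)) v⟫_ℝ = ⟪(P ^ j) u, (P ^ k) v⟫_ℝ := by
  rw [pow_add, Module.End.mul_apply, ← hs.pow j]

/-- For symmetric P, `hP` encodes 0 ≤ P ≤ 1 and replaces the spectral theorem: powers are moved
evenly to both sides, and for odd k one factor P remains in the middle. -/
theorem inner_pow_nonneg (hs : P.IsSymmetric) (hP : ∀ w, ‖P w‖ ^ 2 ≤ ⟪w, P w⟫_ℝ) (k : ℕ) (v : E) :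
    0 ≤ ⟪v, (P ^ k) v⟫_ℝ := by
  rcases Nat.even_or_odd' k with ⟨j, rfl | rfl⟩
  · rw [two_mul, inner_pow_add hs]
    exact real_inner_self_nonneg
  · rw [two_mul, add_assoc, inner_pow_add hs, pow_succ', Module.End.mul_apply]
    exact (sq_nonneg _).trans (hP _)

theorem norm_le_of_firm (hP : ∀ w, ‖P w‖ ^ 2 ≤ ⟪w, P w⟫_ℝ) (w : E) : ‖P w‖ ≤ ‖w‖ := by
  have h1 := hP w
  have h2 := real_inner_le_norm w (P w)
  by_contra! h
  nlinarith [norm_nonneg w, norm_nonneg (P w)]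

theorem inner_pow_antitone (hs : P.IsSymmetric) (hP : ∀ w, ‖P w‖ ^ 2 ≤ ⟪w, P w⟫_ℝ) (v : E) :
    Antitone fun k => ⟪v, (P ^ k) v⟫_ℝ := by
  refine antitone_nat_of_succ_le fun k => ?_
  rcases Nat.even_or_odd' k with ⟨j, rfl | rfl⟩
  · rw [two_mul, add_assoc, inner_pow_add hs j (j + 1), inner_pow_add hs j j, pow_succ',
      Module.End.mul_apply]
    set w := (P ^ j) v
    have h2 := real_inner_le_norm w (P w)
    rw [real_inner_self_eq_norm_sq]
    nlinarith [norm_le_of_firm hP w, norm_nonneg w]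
  · have e : 2 * j + 1 + 1 = (j + 1) + (j + 1) := by ring
    have e' : 2 * j + 1 = j + (j + 1) := by ring
    rw [e, e', inner_pow_add hs (j + 1) (j + 1), inner_pow_add hs j (j + 1), pow_succ', Module.End.mul_apply,
      real_inner_self_eq_norm_sq]
    exact hP _

/-- Spectrally this is ∫ λ^k (λ - c)² dμ ≥ 0. The value c = 1 gives convexity of the moments, c =
⟪v, P v⟫ gives Jensen. -/
theorem inner_pow_convex (hs : P.IsSymmetric) (hP : ∀ w, ‖P w‖ ^ 2 ≤ ⟪w, P w⟫_ℝ) (v : E) (c : ℝ)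
    (k : ℕ) : 0 ≤ ⟪v, (P ^ (k + 2)) v⟫_ℝ - 2 * c * ⟪v, (P ^ (k + 1)) v⟫_ℝ +
      c ^ 2 * ⟪v, (P ^ k) v⟫_ℝ := by
  have h := inner_pow_nonneg hs hP k (P v - c • v)
  have e1 : ⟪P v, (P ^ k) (P v)⟫_ℝ = ⟪v, (P ^ (k + 2)) v⟫_ℝ := by
    rw [hs, ← Module.End.mul_apply, ← pow_succ', ← Module.End.mul_apply, ← pow_succ]
  have e2 : ⟪P v, (P ^ k) v⟫_ℝ = ⟪v, (P ^ (k + 1)) v⟫_ℝ := by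
    rw [hs, ← Module.End.mul_apply, ← pow_succ']
  have e3 : ⟪v, (P ^ k) (P v)⟫_ℝ = ⟪v, (P ^ (k + 1)) v⟫_ℝ := by
    rw [← Module.End.mul_apply, ← pow_succ]
  simp only [map_sub, map_smul, inner_sub_left, inner_sub_right, inner_smul_left,
    inner_smul_right, e1, e2, e3, RCLike.conj_to_real] at h
  linarith

/-- By convexity of the moments the first decrement is the largest. -/
theorem inner_sub_pow_le (hs : P.IsSymmetric) (hP : ∀ w, ‖P w‖ ^ 2 ≤ ⟪w, P w⟫_ℝ) (v : E) (s : ℕ) :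
    ⟪v, v - (P ^ s) v⟫_ℝ ≤ s * ⟪v, v - P v⟫_ℝ := by
  set a : ℕ → ℝ := fun k => ⟪v, (P ^ k) v⟫_ℝ with ha
  have hstep : ∀ k, a k - a (k + 1) ≤ a 0 - a 1 := by
    intro k
    induction k with
    | zero => exact le_rfl
    | succ k ih =>
      have := inner_pow_convex hs hP v 1 k
      simp only [ha] at ih ⊢
      linarith
  have hsum : a 0 - a s ≤ s * (a 0 - a 1) := by
    induction s with
    | zero => simp
    | succ s ih => have := hstep s; push_cast; linarith
  simpa [ha, inner_sub_right] using hsum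

/-- Jensen's inequality for the spectral measure of a unit vector. -/
theorem pow_inner_le_inner_pow (hs : P.IsSymmetric) (hP : ∀ w, ‖P w‖ ^ 2 ≤ ⟪w, P w⟫_ℝ) {v : E}
    (hv : ‖v‖ = 1) (k : ℕ) : ⟪v, P v⟫_ℝ ^ k ≤ ⟪v, (P ^ k) v⟫_ℝ := by
  set c := ⟪v, P v⟫_ℝ with hc
  have hc0 : 0 ≤ c := (sq_nonneg _).trans (hP v)
  have hstep : ∀ k, c * ⟪v, (P ^ k) v⟫_ℝ ≤ ⟪v, (P ^ (k + 1)) v⟫_ℝ := by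
    intro k
    induction k with
    | zero => simp [hv, hc]
    | succ k ih =>
      have := inner_pow_convex hs hP v c k
      have := mul_le_mul_of_nonneg_left ih hc0
      nlinarith
  induction k with
  | zero => simp [hv]
  | succ k ih =>
    rw [pow_succ']
    exact (mul_le_mul_of_nonneg_left ih hc0).trans (hstep k)

theorem firm_pow (hs : P.IsSymmetric) (hP : ∀ w, ‖P w‖ ^ 2 ≤ ⟪w, P w⟫_ℝ) (s : ℕ) (w : E) :
    ‖(P ^ s) w‖ ^ 2 ≤ ⟪w, (P ^ s) w⟫_ℝ := by
  rw [← real_inner_self_eq_norm_sq, ← inner_pow_add hs]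
  exact inner_pow_antitone hs hP w (by omega)

/-- Closeness to a vector of small energy gives stability under the semigroup. -/
theorem inner_sub_pow_le_of_close (hs : P.IsSymmetric) (hP : ∀ w, ‖P w‖ ^ 2 ≤ ⟪w, P w⟫_ℝ)
    (f g : E) (s : ℕ) :
    ⟪f, f - (P ^ s) f⟫_ℝ ≤ 2 * (s * ⟪g, g - P g⟫_ℝ) + 2 * ‖f - g‖ ^ 2 := by
  set u := f - g
  have hu : f = g + u := by simp [u]
  have h1 := inner_sub_pow_le hs hP g s
  -- With Q = P^s, positivity of 1 - Q at g - u removes the cross terms: ⟨f,(1-Q)f⟩ ≤ 2⟨g,(1-Q)g⟩ +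
  -- 2⟨u,(1-Q)u⟩. Then Q ≥ 0 bounds the last term.
  have h2 := inner_pow_nonneg hs hP s u
  have h3 : ⟪g - u, (P ^ s) (g - u)⟫_ℝ ≤ ⟪g - u, g - u⟫_ℝ := by
    simpa using inner_pow_antitone hs hP (g - u) (Nat.zero_le s)
  rw [← real_inner_self_eq_norm_sq, hu]
  simp only [map_sub, map_add, inner_sub_left, inner_sub_right, inner_add_left,
    inner_add_right] at *
  linarith

end Semigroup

/-- Greedy colouring: a new vertex takes a colour not used by its at most Δ neighbours. -/
theorem exists_colouring {V : Type*} [Fintype V] [DecidableEq V] (G : SimpleGraph V)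
    [DecidableRel G.Adj] {Δ : ℕ} (hG : ∀ i, G.degree i ≤ Δ) :
    ∃ χ : V → ℕ, (∀ i, χ i < Δ + 1) ∧ ∀ i j, G.Adj i j → χ i ≠ χ j := by
  suffices h : ∀ S : Finset V, ∃ χ : V → ℕ, (∀ i, χ i < Δ + 1) ∧
      ∀ i ∈ S, ∀ j ∈ S, G.Adj i j → χ i ≠ χ j by
    obtain ⟨χ, h1, h2⟩ := h Finset.univ
    exact ⟨χ, h1, fun i j => h2 i (Finset.mem_univ i) j (Finset.mem_univ j)⟩
  intro S
  induction S using Finset.induction_on with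
  | empty => exact ⟨fun _ => 0, fun _ => Nat.succ_pos Δ, by simp⟩
  | insert a S ha ih =>
    obtain ⟨χ, h1, h2⟩ := ih
    obtain ⟨c, hc, hc'⟩ : ∃ c ∈ Finset.range (Δ + 1), c ∉ (G.neighborFinset a).image χ := by
      refine Finset.exists_mem_notMem_of_card_lt_card ?_
      rw [Finset.card_range]
      exact Nat.lt_succ_of_le (Finset.card_image_le.trans (hG a))
    have hne : ∀ j, G.Adj a j → c ≠ χ j := fun j hj h =>
      hc' (Finset.mem_image.2 ⟨j, by simpa using hj, h.symm⟩)
    refine ⟨Function.update χ a c, fun i => ?_, fun i hi j hj hij => ?_⟩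
    · rcases eq_or_ne i a with rfl | hi
      · simpa using hc
      · simpa [hi] using h1 i
    · rcases eq_or_ne i a with rfl | hia
      · have hja : j ≠ i := hij.ne'
        simpa [hja] using hne j hij
      · rcases eq_or_ne j a with rfl | hja
        · simpa [hia] using (hne i hij.symm).symm
        · simpa [hia, hja] using h2 i (Finset.mem_of_mem_insert_of_ne hi hia) j
            (Finset.mem_of_mem_insert_of_ne hj hja) hij

/-! ### From stability on colour classes to stability under the lazy dynamics. -/

section Stability

open scoped InnerProductSpace

variable {E : Type*} [NormedAddCommGroup E] [InnerProductSpace ℝ E] {n : ℕ}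

/-- The lazy random-site dynamics that applies `1 - D_i` at a uniformly chosen site. -/
def lazyDynamics (D : Fin n → Module.End ℝ E) : Module.End ℝ E :=
  1 - (1 / (2 * n) : ℝ) • ∑ i, D i

theorem inner_sum_proj {D : Fin n → Module.End ℝ E} (hD : ∀ i, (D i).IsSymmetricProjection)
    (w : E) : ⟪w, (∑ i, D i) w⟫_ℝ = ∑ i, ‖D i w‖ ^ 2 := by
  rw [LinearMap.sum_apply, inner_sum]
  exact Finset.sum_congr rfl fun i _ => by rw [real_inner_comm, inner_proj_self (hD i)]

theorem inner_sub_lazyDynamics {D : Fin n → Module.End ℝ E}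
    (hD : ∀ i, (D i).IsSymmetricProjection) (w : E) :
    ⟪w, w - lazyDynamics D w⟫_ℝ = 1 / (2 * n) * ∑ i, ‖D i w‖ ^ 2 := by
  rw [← inner_sum_proj hD, ← inner_smul_right]
  simp [lazyDynamics]

theorem lazyDynamics_symmetric {D : Fin n → Module.End ℝ E}
    (hD : ∀ i, (D i).IsSymmetricProjection) : (lazyDynamics D).IsSymmetric := by
  intro u v
  simp only [lazyDynamics, LinearMap.sub_apply, Module.End.one_apply, LinearMap.smul_apply,
    LinearMap.sum_apply, inner_sub_left, inner_sub_right, inner_smul_left, inner_smul_right,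
    sum_inner, inner_sum, RCLike.conj_to_real]
  simp only [fun i => (hD i).isSymmetric u v]

/-- With e = ∑ ‖D_i w‖², Cauchy–Schwarz gives ‖∑ D_i w‖² ≤ n e. Hence ‖Pw‖² ≤ ‖w‖² - (3/4) e/n,
while ⟨w, Pw⟩ = ‖w‖² - (1/2) e/n. -/
theorem lazyDynamics_firm (hn : 1 ≤ n) {D : Fin n → Module.End ℝ E}
    (hD : ∀ i, (D i).IsSymmetricProjection) (w : E) :
    ‖lazyDynamics D w‖ ^ 2 ≤ ⟪w, lazyDynamics D w⟫_ℝ := by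
  have hn' : (0 : ℝ) < n := by exact_mod_cast hn
  set e := ∑ i, ‖D i w‖ ^ 2 with he
  have he0 : 0 ≤ e := Finset.sum_nonneg fun _ _ => sq_nonneg _
  have hS : ‖(∑ i, D i) w‖ ^ 2 ≤ n * e := by
    rw [LinearMap.sum_apply]
    refine (pow_le_pow_left₀ (norm_nonneg _) (norm_sum_le _ _) 2).trans ?_
    simpa using sq_sum_le_card_mul_sum_sq (s := Finset.univ) (f := fun i => ‖D i w‖)
  have h1 : ‖lazyDynamics D w‖ ^ 2 = ‖w‖ ^ 2 - e / n +
      (1 / (2 * n)) ^ 2 * ‖(∑ i, D i) w‖ ^ 2 := by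
    have : lazyDynamics D w = w - (1 / (2 * n) : ℝ) • (∑ i, D i) w := rfl
    rw [this, norm_sub_sq_real, inner_smul_right, inner_sum_proj hD, norm_smul, mul_pow,
      Real.norm_eq_abs, sq_abs, ← he]
    field_simp
  have h2 : ⟪w, lazyDynamics D w⟫_ℝ = ‖w‖ ^ 2 - e / (2 * n) := by
    have h := inner_sub_lazyDynamics hD w
    rw [inner_sub_right, real_inner_self_eq_norm_sq, ← he] at h
    rw [div_eq_mul_one_div, mul_comm e]
    linarith
  rw [h1, h2]
  have h3 : (1 / (2 * n) : ℝ) ^ 2 * ‖(∑ i, D i) w‖ ^ 2 ≤ (1 / (2 * n)) ^ 2 * (n * e) :=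
    mul_le_mul_of_nonneg_left hS (sq_nonneg _)
  have h4 : (1 / (2 * n) : ℝ) ^ 2 * (n * e) = e / n / 4 := by field_simp; ring
  have h5 : e / (2 * n) = e / n / 2 := by field_simp
  have h6 : 0 ≤ e / n := by positivity
  rw [h5]
  linarith

theorem rpow_le_inner_pow {P : Module.End ℝ E} (hs : P.IsSymmetric)
    (hP : ∀ w, ‖P w‖ ^ 2 ≤ ⟪w, P w⟫_ℝ) {f : E} (hf : ‖f‖ = 1) {s t n N : ℕ} (hs0 : 1 ≤ s)
    (hst : s ≤ t) (hn : 1 ≤ n) (hsn : n ≤ 2 * N * s) (h : 1 / 2 ≤ ⟪f, (P ^ s) f⟫_ℝ) :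
    ((1 / 2 : ℝ) ^ (4 * N)) ^ ((t : ℝ) / n) ≤ ⟪f, (P ^ t) f⟫_ℝ := by
  -- The fewest-plus-at-most-one blocks of length s covering t steps; as s ≤ t, their total length
  -- is at most 2t.
  set k := t / s + 1
  have hk : t ≤ s * k := (Nat.lt_mul_div_succ t hs0).le
  have hk2 : s * k ≤ 2 * t := by
    have := Nat.mul_div_le t s
    simp only [k, mul_add]; omega
  have hkt : (k : ℝ) ≤ (4 * N : ℕ) * ((t : ℝ) / n) := by
    rw [mul_div_assoc', le_div_iff₀ (by exact_mod_cast hn)]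
    norm_cast
    calc k * n ≤ k * (2 * N * s) := Nat.mul_le_mul_left _ hsn
      _ = 2 * N * (s * k) := by ring
      _ ≤ 2 * N * (2 * t) := Nat.mul_le_mul_left _ hk2
      _ = 4 * N * t := by ring
  calc ((1 / 2 : ℝ) ^ (4 * N)) ^ ((t : ℝ) / n)
      = (1 / 2 : ℝ) ^ ((4 * N : ℕ) * ((t : ℝ) / n)) := by
        rw [← Real.rpow_natCast, ← Real.rpow_mul (by norm_num)]
    _ ≤ (1 / 2 : ℝ) ^ (k : ℝ) :=
        Real.rpow_le_rpow_of_exponent_ge (by norm_num) (by norm_num) hkt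
    _ = (1 / 2 : ℝ) ^ k := Real.rpow_natCast _ _
    _ ≤ ⟪f, (P ^ s) f⟫_ℝ ^ k := pow_le_pow_left₀ (by norm_num) h k
    _ ≤ ⟪f, ((P ^ s) ^ k) f⟫_ℝ := pow_inner_le_inner_pow (hs.pow s) (firm_pow hs hP s) hf k
    _ = ⟪f, (P ^ (s * k)) f⟫_ℝ := by rw [pow_mul]
    _ ≤ ⟪f, (P ^ t) f⟫_ℝ := inner_pow_antitone hs hP f hk

/-- The number of blocks that is used on each colour class. -/
def blockCount (Δ : ℕ) : ℕ := (32 * (Δ + 1) ^ 2) ^ 2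

/-- The inverse of a lower bound for the admissible number of steps per site. -/
def stepBound (Δ : ℕ) : ℕ :=
  4 * (2 ^ (Δ + 1) - 1) * ((1 + 2 * 4 ^ Δ * Δ ^ 2) * blockCount Δ)

/-- Stability under partial resampling of each colour class implies stability under the lazy
random-site dynamics. -/
theorem rpow_le_inner_lazyDynamics {Δ : ℕ} (hn : 1 ≤ n) (G : SimpleGraph (Fin n))
    [DecidableRel G.Adj] (hG : ∀ i, G.degree i ≤ Δ) {D : Fin n → Module.End ℝ E}
    (hD : ∀ i, (D i).IsSymmetricProjection) (hc : ∀ i j, ¬ G.Adj i j → Commute (D i) (D j))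
    {f : E} (hf : ‖f‖ = 1)
    (hstable : ∀ l : List (Fin n), l.Nodup → (∀ i ∈ l, ∀ j ∈ l, ¬ G.Adj i j) →
      ⟪f, f - dampProd (1 / blockCount Δ) D l f⟫_ℝ ≤ 2 / √(blockCount Δ))
    {t : ℕ} (ht : n ≤ t) :
    ((1 / 2 : ℝ) ^ (4 * stepBound Δ)) ^ ((t : ℝ) / n) ≤ ⟪f, (lazyDynamics D ^ t) f⟫_ℝ := by
  obtain ⟨χ, hχΔ, hχ⟩ := exists_colouring G hG
  set N := stepBound Δ with hN
  set m := blockCount Δ with hm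
  have hs := lazyDynamics_symmetric hD
  have hP := lazyDynamics_firm hn hD
  have hn' : (0 : ℝ) < n := by exact_mod_cast hn
  have hsqrt : √(m : ℝ) = 32 * (Δ + 1) ^ 2 := by
    rw [hm, blockCount]
    push_cast
    exact Real.sqrt_sq (by positivity)
  have hm2 : 2 ≤ m := by
    rw [hm, blockCount]
    nlinarith [Nat.pos_of_ne_zero (pow_ne_zero 2 (Nat.succ_ne_zero Δ)),
      Nat.le_self_pow two_ne_zero (32 * (Δ + 1) ^ 2)]
  have hm2' : (2 : ℝ) ≤ m := by exact_mod_cast hm2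
  have hκ0 : (0 : ℝ) < 1 / m := by positivity
  have hκ1 : (1 : ℝ) / m ≤ 1 / 2 := one_div_le_one_div_of_le (by norm_num) hm2'
  have hN1 : 1 ≤ N := by
    have : 2 ≤ 2 ^ (Δ + 1) := Nat.le_self_pow (Nat.succ_ne_zero Δ) 2
    rw [hN, stepBound, ← hm]
    exact Nat.one_le_iff_ne_zero.2 (by
      refine mul_ne_zero (by omega) (mul_ne_zero (by positivity) (by omega)))
  -- For n < N the floor n / N vanishes; there s = 1 works, since one lazy step costs at most 1/2.
  by_cases hnN : n < N
  · refine rpow_le_inner_pow hs hP hf le_rfl (hn.trans ht) hn (by omega) ?_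
    have h := inner_sub_lazyDynamics hD f
    have he : ∑ i, ‖D i f‖ ^ 2 ≤ n := by
      calc ∑ i, ‖D i f‖ ^ 2 ≤ ∑ _i : Fin n, (1 : ℝ) := Finset.sum_le_sum fun i _ =>
            pow_le_one₀ (norm_nonneg _) (hf ▸ norm_proj_le (hD i) f)
        _ = n := by simp
    have h2 : 1 / (2 * n) * ∑ i, ‖D i f‖ ^ 2 ≤ 1 / 2 := by
      rw [one_div_mul_eq_div, div_le_iff₀ (by positivity)]
      linarith
    rw [inner_sub_right, real_inner_self_eq_norm_sq, hf] at h
    rw [pow_one]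
    linarith
  · push Not at hnN
    have hs1 : 1 ≤ n / N := (Nat.one_le_div_iff hN1).2 hnN
    refine rpow_le_inner_pow (s := n / N) hs hP hf hs1 ((Nat.div_le_self _ _).trans ht) hn ?_ ?_
    · have := Nat.lt_mul_div_succ n hN1
      nlinarith
    set g := sweep (1 / m : ℝ) D χ f (Δ + 1)
    -- One class moves f by squared distance at most 2 · 2/√m = 1/(8(Δ+1)²). Over Δ + 1 classes this
    -- gives ‖f - g‖² ≤ 1/8, so 2 · 1/8 from the distance and 2 · 1/8 from the energy add up to 1/2.
    have hfg : ‖f - g‖ ≤ (Δ + 1 : ℕ) * (1 / (√8 * (Δ + 1))) := by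
      refine norm_sub_sweep_le hD hκ0.le hκ1 f _ (fun c => ?_) _
      have h1 := hstable (colourClass χ c) (nodup_colourClass χ c) fun i hi j hj hij =>
        hχ i j hij (by rw [mem_colourClass.1 hi, mem_colourClass.1 hj])
      set h := dampProd (1 / m : ℝ) D (colourClass χ c) f
      have h2 : ‖h‖ ≤ 1 := hf ▸ norm_dampProd_le hD hκ0.le (hκ1.trans (by norm_num)) _ f
      refine le_of_sq_le_sq ?_ (by positivity)
      rw [inner_sub_right, real_inner_self_eq_norm_sq, hsqrt, hf] at h1
      rw [norm_sub_sq_real, hf, div_pow, mul_pow, Real.sq_sqrt (by norm_num)]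
      have h3 : (2 : ℝ) / (32 * (Δ + 1) ^ 2) = 1 ^ 2 / (8 * (Δ + 1) ^ 2) / 2 := by
        field_simp; norm_num
      nlinarith [norm_nonneg h]
    have hfg2 : ‖f - g‖ ^ 2 ≤ 1 / 8 := by
      have e : ((Δ + 1 : ℕ) : ℝ) * (1 / (√8 * (Δ + 1))) = 1 / √8 := by
        push_cast; field_simp
      rw [e] at hfg
      have := pow_le_pow_left₀ (norm_nonneg _) hfg 2
      rwa [div_pow, Real.sq_sqrt (by norm_num), one_pow] at this
    have hE : 4 * ∑ i, ‖D i g‖ ^ 2 ≤ N := by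
      have h := energy_sweep_le G hG hχ hD hc hκ0 hκ1 f hf (Δ + 1)
      rw [Finset.filter_true_of_mem fun i _ => hχΔ i] at h
      have e : (N : ℝ) = 4 * ((2 ^ (Δ + 1) - 1) * ((1 + 2 * 4 ^ Δ * Δ ^ 2) / (1 / m))) := by
        rw [hN, stepBound, ← hm]
        push_cast [Nat.one_le_two_pow]
        field_simp
      rw [e]
      linarith
    have h := inner_sub_pow_le_of_close hs hP f g (n / N)
    rw [inner_sub_lazyDynamics hD, inner_sub_right, real_inner_self_eq_norm_sq, hf] at h
    have hle : ((n / N : ℕ) : ℝ) * (1 / (2 * n) * ∑ i, ‖D i g‖ ^ 2) ≤ 1 / 8 := by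
      have h1 : ((n / N : ℕ) : ℝ) * N ≤ n := by exact_mod_cast Nat.div_mul_le_self n N
      have h2 := mul_le_mul_of_nonneg_left hE (Nat.cast_nonneg (α := ℝ) (n / N))
      have e : ((n / N : ℕ) : ℝ) * (1 / (2 * n) * ∑ i, ‖D i g‖ ^ 2) =
          ((n / N : ℕ) : ℝ) * (4 * ∑ i, ‖D i g‖ ^ 2) / (8 * n) := by
        field_simp; ring
      rw [e, div_le_iff₀ (by positivity)]
      linarith
    linarith

end Stability

/-! ### Heat-bath updates as projections in L²(π). -/

section Resampling

variable {n : ℕ}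

/-- Exchange the coordinate `i` of `p.1` with `p.2`. -/
def swapSite {α : Type*} (i : Fin n) : Equiv.Perm ((Fin n → α) × α) :=
  Function.Involutive.toPerm (fun p => (Function.update p.1 i p.2, p.1 i)) fun p => by simp

/-- Exchangeability of the old and the new value at a site; `hφ` is detailed balance for the joint
weight. -/
theorem sum_swapSite {α : Type*} [Fintype α] (i : Fin n) (φ F : (Fin n → α) → α → ℝ)
    (hφ : ∀ x s, φ (Function.update x i s) (x i) = φ x s) :
    ∑ x, ∑ s, φ x s * F (Function.update x i s) (x i) = ∑ x, ∑ s, φ x s * F x s := by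
  rw [← Fintype.sum_prod_type', ← Fintype.sum_prod_type',
    ← Equiv.sum_comp (swapSite i) fun p : (Fin n → α) × α => φ p.1 p.2 * F p.1 p.2]
  refine Finset.sum_congr rfl fun p _ => ?_
  change _ = φ (Function.update p.1 i p.2) (p.1 i) * F (Function.update p.1 i p.2) (p.1 i)
  rw [hφ]

/-- Resampling one coordinate of a product distribution does not change averages. -/
theorem sum_prod_mul_resample {α : Type*} [Fintype α] (q : Fin n → α → ℝ) (i : Fin n)
    (hq : ∑ a, q i a = 1) (F : (Fin n → α) → ℝ) :
    ∑ y : Fin n → α, (∏ k, q k (y k)) * ∑ a, q i a * F (Function.update y i a) =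
      ∑ y : Fin n → α, (∏ k, q k (y k)) * F y := by
  have hprod : ∀ (y : Fin n → α) (a : α),
      (∏ k, q k (Function.update y i a k)) * q i (y i) = (∏ k, q k (y k)) * q i a := by
    intro y a
    rw [← Finset.mul_prod_erase _ _ (Finset.mem_univ i),
      ← Finset.mul_prod_erase Finset.univ (fun k => q k (y k)) (Finset.mem_univ i),
      Function.update_self]
    have : ∏ k ∈ Finset.univ.erase i, q k (Function.update y i a k) =
        ∏ k ∈ Finset.univ.erase i, q k (y k) :=
      Finset.prod_congr rfl fun k hk => by
        rw [Function.update_of_ne (Finset.ne_of_mem_erase hk)]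
    rw [this]
    ring
  have h := sum_swapSite i (fun y a => (∏ k, q k (y k)) * q i a) (fun y _ => F y) hprod
  simp only [mul_assoc, ← Finset.mul_sum] at h
  rw [h]
  simp only [← Finset.sum_mul, hq, one_mul]

theorem sum_prod_eq_one {α : Type*} [Fintype α] (q : Fin n → α → ℝ) (hq : ∀ i, ∑ a, q i a = 1) :
    ∑ y : Fin n → α, ∏ k, q k (y k) = 1 := by
  rw [← Fintype.piFinset_univ, ← Finset.prod_univ_sum]
  simp [hq]

/-- The conditional probability under `π` of the spin `s` at `i`, given the other spins of `x`. -/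
def condProb (π : Config n → ℝ) (i : Fin n) (x : Config n) (s : ℤˣ) : ℝ :=
  π (Function.update x i s) / ∑ r, π (Function.update x i r)

/-- The spins at `i` and `j` are conditionally independent given all other spins. -/
def NonInteracting (π : Config n → ℝ) (i j : Fin n) : Prop :=
  ∀ x s t, π (Function.update (Function.update x i s) j t) * π x =
    π (Function.update x i s) * π (Function.update x j t)

variable {π : Config n → ℝ}

theorem condProb_nonneg (hπ : ∀ x, 0 < π x) (i : Fin n) (x : Config n) (s : ℤˣ) :
    0 ≤ condProb π i x s :=
  div_nonneg (hπ _).le (Finset.sum_nonneg fun _ _ => (hπ _).le)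

theorem sum_condProb (hπ : ∀ x, 0 < π x) (i : Fin n) (x : Config n) :
    ∑ s, condProb π i x s = 1 := by
  simp only [condProb]
  rw [← Finset.sum_div]
  exact div_self (Finset.sum_pos (fun _ _ => hπ _) Finset.univ_nonempty).ne'

theorem condProb_update_self (i : Fin n) (x : Config n) (r s : ℤˣ) :
    condProb π i (Function.update x i r) s = condProb π i x s := by
  simp [condProb]

/-- Changing the spin at j multiplies the weights of both spins at i by the same factor, which
cancels. -/
theorem condProb_update_of_ne (hπ : ∀ x, 0 < π x) {i j : Fin n} (hij : i ≠ j)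
    (h : NonInteracting π i j) (x : Config n) (s t : ℤˣ) :
    condProb π i (Function.update x j t) s = condProb π i x s := by
  have key : ∀ s, π (Function.update (Function.update x j t) i s) =
      π (Function.update x i s) * (π (Function.update x j t) / π x) := fun s => by
    rw [Function.update_comm hij.symm, mul_div_assoc', eq_div_iff (hπ x).ne']
    exact h x s t
  simp only [condProb, key, ← Finset.sum_mul]
  exact mul_div_mul_right _ _ (div_pos (hπ _) (hπ _)).ne'

/-- Detailed balance of the heat bath, the source of self-adjointness and of the exchange symmetry
of blocks. -/
theorem mul_condProb_update (i : Fin n) (x : Config n) (s : ℤˣ) :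
    π (Function.update x i s) * condProb π i (Function.update x i s) (x i) =
      π x * condProb π i x s := by
  rw [condProb_update_self]
  simp only [condProb, Function.update_eq_self]
  ring

/-- Real functions on configurations, with the inner product of `L²(π)`. -/
def WeightedFun (_π : Config n → ℝ) : Type := Config n → ℝ

instance : AddCommGroup (WeightedFun π) := inferInstanceAs (AddCommGroup (Config n → ℝ))

instance : Module ℝ (WeightedFun π) := inferInstanceAs (Module ℝ (Config n → ℝ))

instance : FunLike (WeightedFun π) (Config n) ℝ where
  coe f := f
  coe_injective _ _ h := h

theorem weightedFun_ext {f g : WeightedFun π} (h : ∀ x, f x = g x) : f = g := funext h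

theorem weightedFun_add_apply (f g : WeightedFun π) (x : Config n) : (f + g) x = f x + g x := rfl

theorem weightedFun_sub_apply (f g : WeightedFun π) (x : Config n) : (f - g) x = f x - g x := rfl

theorem weightedFun_smul_apply (c : ℝ) (f : WeightedFun π) (x : Config n) :
    (c • f) x = c * f x := rfl

/-- The inner product of `L²(π)`. -/
@[reducible] def weightedCore (hπ : ∀ x, 0 < π x) : InnerProductSpace.Core ℝ (WeightedFun π) where
  inner f g := ∑ x, π x * (f x * g x)
  conj_inner_symm f g := by
    simp only [RCLike.conj_to_real]
    exact Finset.sum_congr rfl fun x _ => by ring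
  re_inner_nonneg f := Finset.sum_nonneg fun x _ => mul_nonneg (hπ x).le (mul_self_nonneg _)
  add_left f g h := by
    rw [← Finset.sum_add_distrib]
    exact Finset.sum_congr rfl fun x _ => by rw [weightedFun_add_apply]; ring
  smul_left f g c := by
    rw [RCLike.conj_to_real, Finset.mul_sum]
    exact Finset.sum_congr rfl fun x _ => by rw [weightedFun_smul_apply]; ring
  definite f hf := by
    have h := (Finset.sum_eq_zero_iff_of_nonneg
      fun x _ => mul_nonneg (hπ x).le (mul_self_nonneg (f x))).1 hf
    refine weightedFun_ext fun x => ?_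
    exact mul_self_eq_zero.1 ((mul_eq_zero.1 (h x (Finset.mem_univ x))).resolve_left (hπ x).ne')

instance [hπ : Fact (∀ x, 0 < π x)] : NormedAddCommGroup (WeightedFun π) :=
  (weightedCore hπ.out).toNormedAddCommGroup

instance [hπ : Fact (∀ x, 0 < π x)] : InnerProductSpace ℝ (WeightedFun π) :=
  InnerProductSpace.ofCore (weightedCore hπ.out).toCore

theorem weightedFun_inner [Fact (∀ x, 0 < π x)] (f g : WeightedFun π) :
    inner ℝ f g = ∑ x, π x * (f x * g x) := rfl

/-- The heat-bath update at the node `i`, as an operator. -/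
def resample (π : Config n → ℝ) (i : Fin n) : Module.End ℝ (WeightedFun π) where
  toFun f := fun x => ∑ s, condProb π i x s * f (Function.update x i s)
  map_add' f g := by
    funext x
    change ∑ s, condProb π i x s * (f _ + g _) = ∑ s, condProb π i x s * f _ +
      ∑ s, condProb π i x s * g _
    simp only [mul_add, Finset.sum_add_distrib]
  map_smul' c f := by
    funext x
    change ∑ s, condProb π i x s * (c * f _) = c * ∑ s, condProb π i x s * f _
    rw [Finset.mul_sum]
    exact Finset.sum_congr rfl fun s _ => by ring

theorem resample_apply (i : Fin n) (f : WeightedFun π) (x : Config n) :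
    resample π i f x = ∑ s, condProb π i x s * f (Function.update x i s) := rfl

theorem resample_idem (hπ : ∀ x, 0 < π x) (i : Fin n) :
    resample π i * resample π i = resample π i := by
  refine LinearMap.ext fun f => weightedFun_ext fun x => ?_
  simp only [Module.End.mul_apply, resample_apply, condProb_update_self, Function.update_idem,
    ← Finset.sum_mul, sum_condProb hπ, one_mul]

theorem resample_commute (hπ : ∀ x, 0 < π x) {i j : Fin n} (hij : i ≠ j)
    (h : NonInteracting π i j) : Commute (resample π i) (resample π j) := by
  have h' : NonInteracting π j i := fun x s t => by
    rw [Function.update_comm hij.symm, mul_comm (π (Function.update x j s))]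
    exact h x t s
  refine LinearMap.ext fun f => weightedFun_ext fun x => ?_
  simp only [Module.End.mul_apply, resample_apply, condProb_update_of_ne hπ hij h,
    condProb_update_of_ne hπ hij.symm h', Finset.mul_sum]
  rw [Finset.sum_comm]
  refine Finset.sum_congr rfl fun s _ => Finset.sum_congr rfl fun t _ => ?_
  rw [Function.update_comm hij.symm]
  ring

theorem resample_symmetric [hπ : Fact (∀ x, 0 < π x)] (i : Fin n) :
    (resample π i).IsSymmetric := by
  intro f g
  simp only [weightedFun_inner, resample_apply]
  have h := sum_swapSite i (fun x s => π x * condProb π i x s)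
    (fun x s => f (Function.update x i s) * g x) fun x s => mul_condProb_update i x s
  simp only [Function.update_idem, Function.update_eq_self] at h
  have e1 : ∀ x, π x * ((∑ s, condProb π i x s * f (Function.update x i s)) * g x) =
      ∑ s, π x * condProb π i x s * (f (Function.update x i s) * g x) := fun x => by
    rw [Finset.sum_mul, Finset.mul_sum]
    exact Finset.sum_congr rfl fun s _ => by ring
  have e2 : ∀ x, π x * (f x * ∑ s, condProb π i x s * g (Function.update x i s)) =
      ∑ s, π x * condProb π i x s * (f x * g (Function.update x i s)) := fun x => by
    rw [Finset.mul_sum, Finset.mul_sum]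
    exact Finset.sum_congr rfl fun s _ => by ring
  simp only [e1, e2]
  exact h.symm

/-- The generator of the heat-bath update at the node `i`. -/
def fluctuation (π : Config n → ℝ) (i : Fin n) : Module.End ℝ (WeightedFun π) :=
  1 - resample π i

theorem fluctuation_isSymmetricProjection [hπ : Fact (∀ x, 0 < π x)] (i : Fin n) :
    (fluctuation π i).IsSymmetricProjection where
  isIdempotentElem := IsIdempotentElem.one_sub (resample_idem hπ.out i)
  isSymmetric := LinearMap.IsSymmetric.one.sub (resample_symmetric i)

theorem fluctuation_commute (hπ : ∀ x, 0 < π x) {i j : Fin n}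
    (h : i ≠ j → NonInteracting π i j) : Commute (fluctuation π i) (fluctuation π j) := by
  rcases eq_or_ne i j with rfl | hij
  · exact Commute.refl _
  · exact (Commute.one_left _).sub_left
      ((Commute.one_right _).sub_right (resample_commute hπ hij (h hij)))

end Resampling

/-! ### Stability of halfspaces by random blocks. -/

section Blocks

variable {n m : ℕ} {π : Config n → ℝ}

/-- The law of a uniform block label and, for nodes in `l`, an independent resampled spin. -/
def siteLaw (π : Config n → ℝ) (m : ℕ) (l : List (Fin n)) (x : Config n) (i : Fin n)
    (a : Fin m × ℤˣ) : ℝ :=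
  -- Outside `l` the fair spin is a filler that gives total mass 1; refreshing nodes of `l` never
  -- reads it.
  1 / m * if i ∈ l then condProb π i x a.2 else 1 / 2

/-- The joint law of all labels and resampled spins. -/
def noiseLaw (π : Config n → ℝ) (l : List (Fin n)) (x : Config n) (y : Fin n → Fin m × ℤˣ) : ℝ :=
  ∏ i, siteLaw π m l x i (y i)

/-- The configuration `x` with the nodes of `l` that have label `j` replaced by the spins in `y`. -/
def refresh (l : List (Fin n)) (j : Fin m) (x : Config n) (y : Fin n → Fin m × ℤˣ) : Config n :=
  fun i => if i ∈ l ∧ (y i).1 = j then (y i).2 else x i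

theorem sum_units (F : ℤˣ → ℝ) : ∑ s, F s = F 1 + F (-1) := by
  rw [UnitsInt.univ, Finset.sum_pair (by decide)]

theorem siteLaw_nonneg (hπ : ∀ x, 0 < π x) (l : List (Fin n)) (x : Config n) (i : Fin n)
    (a : Fin m × ℤˣ) : 0 ≤ siteLaw π m l x i a := by
  unfold siteLaw
  have := condProb_nonneg hπ i x a.2
  split_ifs <;> positivity

theorem noiseLaw_nonneg (hπ : ∀ x, 0 < π x) (l : List (Fin n)) (x : Config n)
    (y : Fin n → Fin m × ℤˣ) : 0 ≤ noiseLaw π l x y :=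
  Finset.prod_nonneg fun _ _ => siteLaw_nonneg hπ _ _ _ _

theorem sum_siteLaw (hm : 0 < m) (hπ : ∀ x, 0 < π x) (l : List (Fin n)) (x : Config n)
    (i : Fin n) : ∑ a, siteLaw π m l x i a = 1 := by
  have hm' : (m : ℝ) ≠ 0 := by positivity
  have h : ∑ s : ℤˣ, (if i ∈ l then condProb π i x s else 1 / 2) = 1 := by
    split_ifs
    · exact sum_condProb hπ i x
    · rw [sum_units]; norm_num
  simp only [siteLaw]
  rw [← Finset.mul_sum, Fintype.sum_prod_type]
  simp only [h]
  simp [hm']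

theorem sum_noiseLaw (hm : 0 < m) (hπ : ∀ x, 0 < π x) (l : List (Fin n)) (x : Config n) :
    ∑ y : Fin n → Fin m × ℤˣ, noiseLaw π l x y = 1 :=
  sum_prod_eq_one _ (sum_siteLaw hm hπ l x)

/-- The nodes of `l` do not see each other's spins, so the noise law survives replacing any of them.
-/
theorem siteLaw_update (hπ : ∀ x, 0 < π x) {l : List (Fin n)}
    (hl : ∀ i ∈ l, ∀ j ∈ l, i ≠ j → NonInteracting π i j) {a : Fin n} (ha : a ∈ l)
    (x : Config n) (s : ℤˣ) :
    siteLaw π m l (Function.update x a s) = siteLaw π m l x := by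
  funext i b
  unfold siteLaw
  split_ifs with hi
  · rcases eq_or_ne i a with rfl | hia
    · rw [condProb_update_self]
    · rw [condProb_update_of_ne hπ hia (hl i hi a ha hia)]
  · rfl

theorem refresh_update_left {l : List (Fin n)} {j : Fin m} {a : Fin n} (ha : a ∉ l)
    (x : Config n) (s : ℤˣ) (y : Fin n → Fin m × ℤˣ) :
    refresh l j (Function.update x a s) y = Function.update (refresh l j x y) a s := by
  funext i
  rcases eq_or_ne i a with rfl | hi
  · simp [refresh, ha]
  · simp [refresh, hi]

theorem refresh_cons_update {l : List (Fin n)} {j : Fin m} {a : Fin n} (ha : a ∉ l)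
    (x : Config n) (y : Fin n → Fin m × ℤˣ) (b : Fin m × ℤˣ) :
    refresh (a :: l) j x (Function.update y a b) =
      if b.1 = j then Function.update (refresh l j x y) a b.2 else refresh l j x y := by
  funext i
  rcases eq_or_ne i a with rfl | hi
  · split_ifs with h <;> simp [refresh, ha, h]
  · split_ifs with h <;> simp [refresh, hi]

/-- 1 - (1/m) D_i resamples i with probability 1/m, the chance that its label is j. Every single
block j thus represents the same operator. The law is kept on all of `l` while the induction runs
over sublists. -/
theorem dampProd_apply_eq_sum [hπ' : Fact (∀ x, 0 < π x)] (hm : 0 < m) {l : List (Fin n)}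
    (hl : ∀ i ∈ l, ∀ j ∈ l, i ≠ j → NonInteracting π i j) (j : Fin m) (f : WeightedFun π) :
    ∀ l' : List (Fin n), l'.Nodup → l' ⊆ l → ∀ x,
      dampProd (1 / m : ℝ) (fluctuation π) l' f x =
        ∑ y : Fin n → Fin m × ℤˣ, noiseLaw π l x y * f (refresh l' j x y) := by
  have hm' : (m : ℝ) ≠ 0 := by positivity
  have hπ := hπ'.out
  intro l'
  induction l' with
  | nil =>
    intro _ _ x
    have : ∀ y : Fin n → Fin m × ℤˣ, refresh [] j x y = x := fun y => by
      funext i; simp [refresh]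
    simp only [this, ← Finset.sum_mul, sum_noiseLaw hm hπ, one_mul]
    rfl
  | cons a l' ih =>
    intro hnd hsub x
    rw [List.nodup_cons] at hnd
    have ha : a ∈ l := hsub List.mem_cons_self
    have ih := ih hnd.2 fun i hi => hsub (List.mem_cons_of_mem a hi)
    rw [dampProd_cons]
    set u := dampProd (1 / m : ℝ) (fluctuation π) l' f
    have e1 : (u - (1 / m : ℝ) • fluctuation π a u) x =
        u x - 1 / m * (u x - ∑ s, condProb π a x s * u (Function.update x a s)) := rfl
    have hlaw : ∀ s (y : Fin n → Fin m × ℤˣ),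
        noiseLaw π l (Function.update x a s) y = noiseLaw π l x y := fun s y => by
      unfold noiseLaw
      rw [siteLaw_update hπ hl ha]
    rw [e1]
    simp only [ih, hlaw, refresh_update_left hnd.1]
    refine Eq.trans ?_ (sum_prod_mul_resample (siteLaw π m l x) a (sum_siteLaw hm hπ l x a)
      fun y => f (refresh (a :: l') j x y))
    have e2 : ∀ y : Fin n → Fin m × ℤˣ,
        ∑ b, siteLaw π m l x a b * f (refresh (a :: l') j x (Function.update y a b)) =
          f (refresh l' j x y) - 1 / m * (f (refresh l' j x y) -
            ∑ s, condProb π a x s * f (Function.update (refresh l' j x y) a s)) := by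
      intro y
      simp only [refresh_cons_update hnd.1, siteLaw, if_pos ha]
      rw [Fintype.sum_prod_type]
      have e3 : ∀ k : Fin m, ∑ s : ℤˣ, 1 / (m : ℝ) * condProb π a x s *
          f (if k = j then Function.update (refresh l' j x y) a s else refresh l' j x y) =
          1 / m * f (refresh l' j x y) + if k = j then
            1 / m * ((∑ s, condProb π a x s * f (Function.update (refresh l' j x y) a s)) -
              f (refresh l' j x y)) else 0 := by
        intro k
        split_ifs
        · simp only [mul_assoc, ← Finset.mul_sum]; ring
        · rw [← Finset.sum_mul, ← Finset.mul_sum, sum_condProb hπ]; ring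
      simp only [e3]
      rw [Finset.sum_add_distrib, Finset.sum_ite_eq' Finset.univ j]
      simp only [Finset.mem_univ, if_true, Finset.sum_const, Finset.card_univ, Fintype.card_fin,
        nsmul_eq_mul]
      field_simp
      ring
    simp only [e2]
    change _ = ∑ y : Fin n → Fin m × ℤˣ, noiseLaw π l x y * (f (refresh l' j x y) - 1 / m *
      (f (refresh l' j x y) -
        ∑ s, condProb π a x s * f (Function.update (refresh l' j x y) a s)))
    simp only [mul_sub, Finset.sum_sub_distrib, Finset.mul_sum]
    congr 1
    congr 1
    · exact Finset.sum_congr rfl fun y _ => by ring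
    · rw [Finset.sum_comm]
      exact Finset.sum_congr rfl fun y _ => Finset.sum_congr rfl fun s _ => by ring

/-- Exchange `x` and the resampled spins at all nodes of `l` with label `j`. -/
def exchange (l : List (Fin n)) (j : Fin m) (p : Config n × (Fin n → Fin m × ℤˣ)) :
    Config n × (Fin n → Fin m × ℤˣ) :=
  (refresh l j p.1 p.2, fun i => if i ∈ l ∧ (p.2 i).1 = j then (j, p.1 i) else p.2 i)

theorem exchange_involutive (l : List (Fin n)) (j : Fin m) :
    Function.Involutive (exchange l j) := by
  rintro ⟨x, y⟩
  refine Prod.ext (funext fun i => ?_) (funext fun i => ?_)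
  · by_cases h : i ∈ l ∧ (y i).1 = j <;> simp [exchange, refresh, h]
  · by_cases h : i ∈ l ∧ (y i).1 = j
    · simp only [exchange, refresh, h, and_self, if_true]
      rw [← h.2]
    · simp [exchange, refresh, h]

theorem exchange_cons {l : List (Fin n)} {a : Fin n} (ha : a ∉ l) (j : Fin m)
    (p : Config n × (Fin n → Fin m × ℤˣ)) :
    exchange (a :: l) j p = exchange [a] j (exchange l j p) := by
  obtain ⟨x, y⟩ := p
  refine Prod.ext (funext fun i => ?_) (funext fun i => ?_) <;>
  · rcases eq_or_ne i a with rfl | hi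
    · simp [exchange, refresh, ha]
    · simp [exchange, refresh, hi]

/-- The joint law of a configuration drawn from `π` and of its noise. -/
def jointLaw (π : Config n → ℝ) (l : List (Fin n)) (p : Config n × (Fin n → Fin m × ℤˣ)) : ℝ :=
  π p.1 * noiseLaw π l p.1 p.2

/-- Detailed balance handles the factor at a; the other noise factors do not see the spin at a. -/
theorem jointLaw_exchange_singleton (hπ : ∀ x, 0 < π x) {l : List (Fin n)}
    (hl : ∀ i ∈ l, ∀ j ∈ l, i ≠ j → NonInteracting π i j) {a : Fin n} (ha : a ∈ l) (j : Fin m)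
    (p : Config n × (Fin n → Fin m × ℤˣ)) :
    jointLaw π l (exchange [a] j p) = jointLaw π l p := by
  obtain ⟨x, y⟩ := p
  by_cases h : (y a).1 = j
  · have e : exchange [a] j (x, y) =
        (Function.update x a (y a).2, Function.update y a (j, x a)) := by
      refine Prod.ext (funext fun i => ?_) (funext fun i => ?_) <;>
      · rcases eq_or_ne i a with rfl | hi
        · simp [exchange, refresh, h]
        · simp [exchange, refresh, hi]
    rw [e]
    simp only [jointLaw, noiseLaw, siteLaw_update hπ hl ha]
    rw [← Finset.mul_prod_erase _ _ (Finset.mem_univ a),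
      ← Finset.mul_prod_erase Finset.univ (fun i => siteLaw π m l x i (y i)) (Finset.mem_univ a),
      Function.update_self]
    have : ∏ i ∈ Finset.univ.erase a, siteLaw π m l x i (Function.update y a (j, x a) i) =
        ∏ i ∈ Finset.univ.erase a, siteLaw π m l x i (y i) :=
      Finset.prod_congr rfl fun i hi => by
        rw [Function.update_of_ne (Finset.ne_of_mem_erase hi)]
    rw [this]
    have hb := mul_condProb_update (π := π) a x (y a).2
    rw [condProb_update_self] at hb
    simp only [siteLaw, if_pos ha]
    linear_combination (1 / (m : ℝ) * ∏ i ∈ Finset.univ.erase a,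
      (1 / (m : ℝ) * if i ∈ l then condProb π i x (y i).2 else 1 / 2)) * hb
  · have e : exchange [a] j (x, y) = (x, y) := by
      refine Prod.ext (funext fun i => ?_) (funext fun i => ?_) <;>
      · rcases eq_or_ne i a with rfl | hi
        · simp [exchange, refresh, h]
        · simp [exchange, refresh, hi]
    rw [e]

theorem jointLaw_exchange (hπ : ∀ x, 0 < π x) {l : List (Fin n)}
    (hl : ∀ i ∈ l, ∀ j ∈ l, i ≠ j → NonInteracting π i j) (j : Fin m)
    (p : Config n × (Fin n → Fin m × ℤˣ)) :
    ∀ l' : List (Fin n), l'.Nodup → l' ⊆ l →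
      jointLaw π l (exchange l' j p) = jointLaw π l p := by
  intro l'
  induction l' with
  | nil => intro _ _; congr 1
  | cons a l' ih =>
    intro hnd hsub
    rw [List.nodup_cons] at hnd
    rw [exchange_cons hnd.1, jointLaw_exchange_singleton hπ hl (hsub List.mem_cons_self),
      ih hnd.2 fun i hi => hsub (List.mem_cons_of_mem a hi)]

theorem sum_jointLaw_exchange (hπ : ∀ x, 0 < π x) {l : List (Fin n)} (hnd : l.Nodup)
    (hl : ∀ i ∈ l, ∀ j ∈ l, i ≠ j → NonInteracting π i j) (j : Fin m)
    (F : Config n × (Fin n → Fin m × ℤˣ) → ℝ) :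
    ∑ p, jointLaw π l p * F (exchange l j p) = ∑ p, jointLaw π l p * F p := by
  rw [← Equiv.sum_comp (exchange_involutive l j).toPerm fun p => jointLaw π l p * F p]
  refine Finset.sum_congr rfl fun p _ => ?_
  rw [Function.Involutive.coe_toPerm, jointLaw_exchange hπ hl j p l hnd fun _ h => h]

/-- The linear form of a halfspace. -/
def linearForm (w : Fin n → ℝ) (x : Config n) : ℝ := ∑ i, w i * spin (x i)

/-- The real-valued indicator of a halfspace, with values `1` and `-1`. -/
def signForm (w : Fin n → ℝ) (x : Config n) : ℝ := spin (halfspace w x)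

theorem signForm_eq (w : Fin n → ℝ) (x : Config n) :
    signForm w x = if 0 ≤ linearForm w x then 1 else -1 := by
  unfold signForm halfspace linearForm
  split_ifs <;> simp [spin]

theorem signForm_mul_self (w : Fin n → ℝ) (x : Config n) : signForm w x * signForm w x = 1 := by
  rw [signForm_eq]; split_ifs <;> norm_num

/-- The direction in which the exchange of block `j` moves the linear form. -/
def blockSign (w : Fin n → ℝ) (l : List (Fin n)) (j : Fin m)
    (p : Config n × (Fin n → Fin m × ℤˣ)) : ℝ :=
  Real.sign (linearForm w p.1 - linearForm w (refresh l j p.1 p.2))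

/-- The halfspace is monotone in its linear form, so whenever its value changes, both change in the
same direction. -/
theorem one_sub_signForm_mul (w : Fin n → ℝ) (x z : Config n) :
    1 - signForm w x * signForm w z =
      (signForm w x - signForm w z) * Real.sign (linearForm w x - linearForm w z) := by
  rw [signForm_eq, signForm_eq]
  split_ifs with h1 h2 h2
  · norm_num
  · rw [Real.sign_of_pos (by linarith)]; norm_num
  · rw [Real.sign_of_neg (by linarith)]; norm_num
  · norm_num

theorem blockSign_exchange_self (w : Fin n → ℝ) (l : List (Fin n)) (j : Fin m)
    (p : Config n × (Fin n → Fin m × ℤˣ)) :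
    blockSign w l j (exchange l j p) = -blockSign w l j p := by
  have h : refresh l j (exchange l j p).1 (exchange l j p).2 = p.1 :=
    congrArg Prod.fst (exchange_involutive l j p)
  unfold blockSign
  rw [h, ← Real.sign_neg, neg_sub]
  rfl

/-- Linearity enters here: the change of the form on block k involves only the nodes of block k. -/
theorem blockSign_exchange_of_ne (w : Fin n → ℝ) (l : List (Fin n)) {j k : Fin m} (hjk : j ≠ k)
    (p : Config n × (Fin n → Fin m × ℤˣ)) :
    blockSign w l k (exchange l j p) = blockSign w l k p := by
  unfold blockSign linearForm
  rw [← Finset.sum_sub_distrib, ← Finset.sum_sub_distrib]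
  congr 1
  refine Finset.sum_congr rfl fun i _ => ?_
  by_cases hi : i ∈ l
  · by_cases h : (p.2 i).1 = j
    · simp [exchange, refresh, h, hi, hjk]
    · simp [exchange, refresh, h, hi]
  · simp [exchange, refresh, hi]

theorem sum_blockSign_mul_eq_zero (hπ : ∀ x, 0 < π x) {l : List (Fin n)} (hnd : l.Nodup)
    (hl : ∀ i ∈ l, ∀ j ∈ l, i ≠ j → NonInteracting π i j) (w : Fin n → ℝ) {j k : Fin m}
    (hjk : j ≠ k) : ∑ p, jointLaw π l p * (blockSign w l j p * blockSign w l k p) = 0 := by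
  have h := sum_jointLaw_exchange hπ hnd hl j fun p => blockSign w l j p * blockSign w l k p
  simp only [blockSign_exchange_self, blockSign_exchange_of_ne w l hjk, neg_mul, mul_neg,
    Finset.sum_neg_distrib] at h
  linarith

theorem sum_jointLaw (hm : 0 < m) (hπ : ∀ x, 0 < π x) (hπ1 : ∑ x, π x = 1) (l : List (Fin n)) :
    ∑ p : Config n × (Fin n → Fin m × ℤˣ), jointLaw π l p = 1 := by
  simp only [jointLaw, Fintype.sum_prod_type, ← Finset.mul_sum, sum_noiseLaw hm hπ, mul_one, hπ1]

theorem blockSign_mul_self_le (w : Fin n → ℝ) (l : List (Fin n)) (j : Fin m)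
    (p : Config n × (Fin n → Fin m × ℤˣ)) : blockSign w l j p * blockSign w l j p ≤ 1 := by
  unfold blockSign
  rcases Real.sign_apply_eq (linearForm w p.1 - linearForm w (refresh l j p.1 p.2)) with
    h | h | h <;> rw [h] <;> norm_num

theorem sum_sq_sum_blockSign_le (hm : 0 < m) (hπ : ∀ x, 0 < π x) (hπ1 : ∑ x, π x = 1)
    {l : List (Fin n)} (hnd : l.Nodup) (hl : ∀ i ∈ l, ∀ j ∈ l, i ≠ j → NonInteracting π i j)
    (w : Fin n → ℝ) :
    ∑ p, jointLaw π l p * (∑ j : Fin m, blockSign w l j p) ^ 2 ≤ m := by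
  have e : ∀ p, jointLaw π l p * (∑ j : Fin m, blockSign w l j p) ^ 2 =
      ∑ j : Fin m, ∑ k : Fin m, jointLaw π l p * (blockSign w l j p * blockSign w l k p) := by
    intro p
    rw [sq, Finset.sum_mul_sum, Finset.mul_sum]
    simp only [Finset.mul_sum]
  simp only [e]
  rw [Finset.sum_comm]
  calc _ ≤ ∑ _j : Fin m, (1 : ℝ) := Finset.sum_le_sum fun j _ => ?_
    _ = m := by simp
  rw [Finset.sum_comm, Finset.sum_eq_single j
    (fun k _ hk => sum_blockSign_mul_eq_zero hπ hnd hl w hk.symm) (by simp)]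
  calc _ ≤ ∑ p : Config n × (Fin n → Fin m × ℤˣ), jointLaw π l p * 1 :=
        Finset.sum_le_sum fun p _ => mul_le_mul_of_nonneg_left (blockSign_mul_self_le w l j p)
          (mul_nonneg (hπ _).le (noiseLaw_nonneg hπ _ _ _))
    _ = 1 := by simp only [mul_one]; exact sum_jointLaw hm hπ hπ1 l

/-- A halfspace is stable under partial resampling of a set of non-interacting nodes. -/
theorem inner_sub_dampProd_signForm_le [hπ : Fact (∀ x, 0 < π x)] (hπ1 : ∑ x, π x = 1)
    (hm : 0 < m) {l : List (Fin n)} (hnd : l.Nodup)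
    (hl : ∀ i ∈ l, ∀ j ∈ l, i ≠ j → NonInteracting π i j) (w : Fin n → ℝ)
    (f : WeightedFun π) (hf : ∀ x, f x = signForm w x) :
    inner ℝ f (f - dampProd (1 / m : ℝ) (fluctuation π) l f) ≤ 2 / √m := by
  set c := inner ℝ f (f - dampProd (1 / m : ℝ) (fluctuation π) l f) with hc
  -- The exchange turns the term with the refreshed configuration into minus the term with the
  -- original one, so their difference doubles.
  have hblock : ∀ j : Fin m,
      c = 2 * ∑ p, jointLaw π l p * (signForm w p.1 * blockSign w l j p) := by
    intro j
    have h := sum_jointLaw_exchange hπ.out hnd hl j fun p => signForm w p.1 * blockSign w l j p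
    simp only [blockSign_exchange_self, mul_neg, Finset.sum_neg_distrib] at h
    have e : c = ∑ p, jointLaw π l p *
        ((signForm w p.1 - signForm w (exchange l j p).1) * blockSign w l j p) := by
      rw [hc, weightedFun_inner, Fintype.sum_prod_type]
      refine Finset.sum_congr rfl fun x _ => ?_
      rw [weightedFun_sub_apply, dampProd_apply_eq_sum hm hl j f l hnd fun _ h => h]
      have : f x = ∑ y : Fin n → Fin m × ℤˣ, noiseLaw π l x y * f x := by
        rw [← Finset.sum_mul, sum_noiseLaw hm hπ.out, one_mul]
      nth_rewrite 2 [this]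
      rw [← Finset.sum_sub_distrib, Finset.mul_sum, Finset.mul_sum]
      refine Finset.sum_congr rfl fun y _ => ?_
      have h1 := one_sub_signForm_mul w x (refresh l j x y)
      rw [← signForm_mul_self w x] at h1
      simp only [jointLaw, blockSign, exchange]
      rw [← h1, hf, hf]
      ring
    rw [e]
    simp only [sub_mul, mul_sub, Finset.sum_sub_distrib]
    linarith
  have hmc : m * c =
      2 * ∑ p, jointLaw π l p * (signForm w p.1 * ∑ j : Fin m, blockSign w l j p) := by
    have : (m : ℝ) * c = ∑ _j : Fin m, c := by simp
    rw [this, Finset.sum_congr rfl fun j _ => hblock j, ← Finset.mul_sum, Finset.sum_comm]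
    simp only [Finset.mul_sum]
  have hr : 0 < √(m : ℝ) := Real.sqrt_pos.2 (by exact_mod_cast hm)
  have hrr : √(m : ℝ) * √m = m := Real.mul_self_sqrt (Nat.cast_nonneg m)
  -- Cauchy–Schwarz in the form 2√m · fT ≤ m + T², with f² = 1 and E T² ≤ m.
  have hbound : √m * (2 * ∑ p, jointLaw π l p *
      (signForm w p.1 * ∑ j : Fin m, blockSign w l j p)) ≤ m * 1 + m := by
    rw [← sum_jointLaw hm hπ.out hπ1 l]
    refine le_trans ?_ (add_le_add le_rfl
      (sum_sq_sum_blockSign_le hm hπ.out hπ1 hnd hl w))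
    rw [Finset.mul_sum, Finset.mul_sum, Finset.mul_sum, ← Finset.sum_add_distrib]
    refine Finset.sum_le_sum fun p _ => ?_
    set T := ∑ j : Fin m, blockSign w l j p
    have h0 : 0 ≤ jointLaw π l p := mul_nonneg (hπ.out _).le (noiseLaw_nonneg hπ.out _ _ _)
    have h1 := signForm_mul_self w p.1
    have h2 : 2 * √m * (signForm w p.1 * T) ≤ m + T ^ 2 := by
      have e : (√m * signForm w p.1 - T) ^ 2 = (√m * √m) * (signForm w p.1 * signForm w p.1) -
        2 * √m * (signForm w p.1 * T) + T ^ 2 := by ring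
      rw [hrr, h1] at e
      linarith [sq_nonneg (√m * signForm w p.1 - T)]
    have := mul_le_mul_of_nonneg_left h2 h0
    linarith
  rw [← hmc] at hbound
  rw [le_div_iff₀ hr]
  have h3 : (0 : ℝ) < m := by exact_mod_cast hm
  refine le_of_mul_le_mul_left ?_ h3
  linarith

end Blocks

/-! ### The Ising model and its Glauber dynamics. -/

section Gibbs

variable {n : ℕ} (G : SimpleGraph (Fin n)) [DecidableRel G.Adj] (J : Sym2 (Fin n) → ℝ) (B : ℝ)

theorem partition_pos : 0 < ∑ τ : Config n, Real.exp (-hamiltonian G J B τ) :=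
  Finset.sum_pos (fun _ _ => Real.exp_pos _) Finset.univ_nonempty

theorem gibbs_pos (σ : Config n) : 0 < gibbs G J B σ :=
  div_pos (Real.exp_pos _) (partition_pos G J B)

theorem sum_gibbs : ∑ σ, gibbs G J B σ = 1 := by
  simp only [gibbs]
  rw [← Finset.sum_div]
  exact div_self (partition_pos G J B).ne'

instance : Fact (∀ σ, 0 < gibbs G J B σ) := ⟨gibbs_pos G J B⟩

theorem edgeSpin_update_of_notMem {e : Sym2 (Fin n)} {i : Fin n} (h : i ∉ e) (σ : Config n)
    (s : ℤˣ) : edgeSpin (Function.update σ i s) e = edgeSpin σ e := by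
  induction e with
  | _ a b =>
    rw [Sym2.mem_iff, not_or] at h
    simp [edgeSpin, Ne.symm h.1, Ne.symm h.2]

/-- No edge contains both i and j, so each term of the energy depends on at most one of the two
spins. -/
theorem hamiltonian_update_update {i j : Fin n} (hij : i ≠ j) (hadj : ¬ G.Adj i j) (σ : Config n)
    (s t : ℤˣ) :
    hamiltonian G J B (Function.update (Function.update σ i s) j t) + hamiltonian G J B σ =
      hamiltonian G J B (Function.update σ i s) + hamiltonian G J B (Function.update σ j t) := by
  have h1 : ∑ e ∈ G.edgeFinset, J e * edgeSpin (Function.update (Function.update σ i s) j t) e +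
      ∑ e ∈ G.edgeFinset, J e * edgeSpin σ e =
      ∑ e ∈ G.edgeFinset, J e * edgeSpin (Function.update σ i s) e +
      ∑ e ∈ G.edgeFinset, J e * edgeSpin (Function.update σ j t) e := by
    rw [← Finset.sum_add_distrib, ← Finset.sum_add_distrib]
    refine Finset.sum_congr rfl fun e he => ?_
    by_cases hi : i ∈ e
    · have hj : j ∉ e := fun hj => by
        rw [(Sym2.mem_and_mem_iff hij).1 ⟨hi, hj⟩, SimpleGraph.mem_edgeFinset] at he
        exact hadj he
      simp only [edgeSpin_update_of_notMem hj]
    · rw [Function.update_comm hij]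
      simp only [edgeSpin_update_of_notMem hi]
      ring
  have h2 : ∑ k, spin (Function.update (Function.update σ i s) j t k) + ∑ k, spin (σ k) =
      ∑ k, spin (Function.update σ i s k) + ∑ k, spin (Function.update σ j t k) := by
    rw [← Finset.sum_add_distrib, ← Finset.sum_add_distrib]
    refine Finset.sum_congr rfl fun k _ => ?_
    rcases eq_or_ne k j with rfl | hk
    · simp [hij.symm, add_comm]
    · simp [hk]
  unfold hamiltonian
  linear_combination -h1 - B * h2

theorem nonInteracting_gibbs {i j : Fin n} (hij : i ≠ j) (hadj : ¬ G.Adj i j) :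
    NonInteracting (gibbs G J B) i j := by
  intro σ s t
  simp only [gibbs]
  rw [div_mul_div_comm, div_mul_div_comm, ← Real.exp_add, ← Real.exp_add, ← neg_add, ← neg_add,
    hamiltonian_update_update G J B hij hadj]

theorem resample_gibbs_apply (i : Fin n) (f : WeightedFun (gibbs G J B)) (σ : Config n) :
    resample (gibbs G J B) i f σ =
      flipProb G J B σ i * f (flip σ i) + (1 - flipProb G J B σ i) * f σ := by
  have hZ := (partition_pos G J B).ne'
  have key : ∀ s : ℤˣ, condProb (gibbs G J B) i σ s =
      Real.exp (-hamiltonian G J B (Function.update σ i s)) /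
        (Real.exp (-hamiltonian G J B (Function.update σ i 1)) +
          Real.exp (-hamiltonian G J B (Function.update σ i (-1)))) := fun s => by
    rw [condProb, sum_units]
    simp only [gibbs]
    rw [← add_div, div_div_div_cancel_right₀ hZ]
  have hpos : ∀ a b : ℝ, Real.exp a + Real.exp b ≠ 0 := fun a b => by positivity
  rw [resample_apply, sum_units, key, key]
  unfold flipProb flip
  rcases Int.units_eq_one_or (σ i) with h | h
  · have e : Function.update σ i 1 = σ := by rw [← h, Function.update_eq_self]
    rw [h, e]
    field_simp [hpos]
    ring
  · have e : Function.update σ i (-1) = σ := by rw [← h, Function.update_eq_self]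
    rw [h, e, neg_neg]
    field_simp [hpos]
    ring

theorem lazyDynamics_apply (hn : 1 ≤ n) (f : WeightedFun (gibbs G J B)) (σ : Config n) :
    lazyDynamics (fluctuation (gibbs G J B)) f σ = ∑ τ, glauber G J B σ τ * f τ := by
  have hn' : (n : ℝ) ≠ 0 := by positivity
  have e1 : lazyDynamics (fluctuation (gibbs G J B)) f σ =
      f σ - 1 / (2 * n) * ∑ i, (f σ - resample (gibbs G J B) i f σ) := by
    have h : lazyDynamics (fluctuation (gibbs G J B)) f =
        f - (1 / (2 * n) : ℝ) • ∑ i, (f - resample (gibbs G J B) i f) := by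
      simp [lazyDynamics, fluctuation]
    have hsum : (∑ i, (f - resample (gibbs G J B) i f)) σ =
        ∑ i, (f σ - resample (gibbs G J B) i f σ) := by
      exact Finset.sum_apply σ Finset.univ fun i => (f - resample (gibbs G J B) i f)
    rw [h, weightedFun_sub_apply, weightedFun_smul_apply, hsum]
  have e2 : ∑ τ, glauber G J B σ τ * f τ =
      ∑ i : Fin n, 1 / (n : ℝ) * (1 / 2 * f σ + 1 / 2 * (flipProb G J B σ i * f (flip σ i) +
        (1 - flipProb G J B σ i) * f σ)) := by
    simp only [glauber, Finset.sum_mul]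
    rw [Finset.sum_comm]
    refine Finset.sum_congr rfl fun i _ => ?_
    have e3 : ∀ τ, 1 / (n : ℝ) * (1 / 2 * (if τ = σ then 1 else 0) +
        1 / 2 * (flipProb G J B σ i * (if τ = flip σ i then 1 else 0) +
          (1 - flipProb G J B σ i) * (if τ = σ then 1 else 0))) * f τ =
        (if τ = σ then 1 / (n : ℝ) * (1 / 2 + 1 / 2 * (1 - flipProb G J B σ i)) * f τ else 0) +
        (if τ = flip σ i then 1 / (n : ℝ) * (1 / 2 * flipProb G J B σ i) * f τ else 0) := by
      intro τ
      split_ifs <;> ring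
    simp only [e3]
    rw [Finset.sum_add_distrib, Finset.sum_ite_eq' Finset.univ σ,
      Finset.sum_ite_eq' Finset.univ (flip σ i)]
    simp only [Finset.mem_univ, if_true]
    ring
  rw [e1, e2]
  simp only [← resample_gibbs_apply, ← Finset.mul_sum, Finset.sum_add_distrib,
    Finset.sum_sub_distrib, Finset.sum_const, Finset.card_univ, Fintype.card_fin, nsmul_eq_mul]
  field_simp
  ring

theorem lazyDynamics_pow_apply (hn : 1 ≤ n) (t : ℕ) (f : WeightedFun (gibbs G J B))
    (σ : Config n) :
    (lazyDynamics (fluctuation (gibbs G J B)) ^ t) f σ =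
      ∑ τ, (glauber G J B ^ t) σ τ * f τ := by
  induction t generalizing σ with
  | zero =>
    simp only [pow_zero, Module.End.one_apply, Matrix.one_apply, ite_mul, one_mul, zero_mul]
    rw [Finset.sum_ite_eq Finset.univ σ fun τ => f τ, if_pos (Finset.mem_univ σ)]
  | succ t ih =>
    rw [pow_succ', Module.End.mul_apply, lazyDynamics_apply G J B hn, pow_succ']
    simp only [ih, Matrix.mul_apply, Finset.mul_sum, Finset.sum_mul]
    rw [Finset.sum_comm]
    exact Finset.sum_congr rfl fun _ _ => Finset.sum_congr rfl fun _ _ => by ring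

/-- Constants are killed by every D_i, hence fixed by the dynamics. -/
theorem sum_glauber_pow (hn : 1 ≤ n) (t : ℕ) (σ : Config n) :
    ∑ τ, (glauber G J B ^ t) σ τ = 1 := by
  let u : WeightedFun (gibbs G J B) := fun _ => 1
  have hD : ∀ i, fluctuation (gibbs G J B) i u = 0 := fun i => by
    refine weightedFun_ext fun x => ?_
    change 1 - ∑ s, condProb (gibbs G J B) i x s * 1 = 0
    simp only [mul_one, sum_condProb (gibbs_pos G J B), sub_self]
  have hP : lazyDynamics (fluctuation (gibbs G J B)) u = u := by
    simp [lazyDynamics, hD]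
  have hPt : (lazyDynamics (fluctuation (gibbs G J B)) ^ t) u = u := by
    induction t with
    | zero => rfl
    | succ t ih => rw [pow_succ, Module.End.mul_apply, hP, ih]
  have h := lazyDynamics_pow_apply G J B hn t u σ
  rw [hPt] at h
  change 1 = ∑ τ, (glauber G J B ^ t) σ τ * 1 at h
  simpa using h.symm

theorem one_sub_two_mul_noiseSensitivity (hn : 1 ≤ n) (t : ℕ) (w : Fin n → ℝ)
    (f : WeightedFun (gibbs G J B)) (hf : ∀ σ, f σ = signForm w σ) :
    1 - 2 * noiseSensitivity (gibbs G J B) (glauber G J B) t (halfspace w) =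
      inner ℝ f ((lazyDynamics (fluctuation (gibbs G J B)) ^ t) f) := by
  have h1 : (1 : ℝ) = ∑ σ, ∑ τ, gibbs G J B σ * (glauber G J B ^ t) σ τ := by
    simp only [← Finset.mul_sum, sum_glauber_pow G J B hn, mul_one, sum_gibbs]
  rw [weightedFun_inner, noiseSensitivity]
  nth_rewrite 1 [h1]
  rw [Finset.mul_sum, ← Finset.sum_sub_distrib]
  refine Finset.sum_congr rfl fun σ _ => ?_
  rw [lazyDynamics_pow_apply G J B hn, Finset.mul_sum, Finset.mul_sum, Finset.mul_sum,
    ← Finset.sum_sub_distrib]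
  refine Finset.sum_congr rfl fun τ _ => ?_
  have h2 : f σ * f τ = 1 - 2 * if halfspace w σ ≠ halfspace w τ then 1 else 0 := by
    rw [hf, hf, signForm, signForm]
    rcases Int.units_eq_one_or (halfspace w σ) with ha | ha <;>
      rcases Int.units_eq_one_or (halfspace w τ) with hb | hb <;>
      rw [ha, hb] <;> norm_num [spin]
  linear_combination (-gibbs G J B σ * (glauber G J B ^ t) σ τ) * h2

/-- Halfspaces are noise stable under the Glauber dynamics of every Ising model on a graph of bounded
degree, with a constant that depends on the degree only. -/
theorem halfspace_noise_stability {Δ : ℕ} (hn : 1 ≤ n) (hG : ∀ i, G.degree i ≤ Δ)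
    (w : Fin n → ℝ) {t : ℕ} (ht : n ≤ t) :
    ((1 / 2 : ℝ) ^ (4 * stepBound Δ)) ^ ((t : ℝ) / n) ≤
      1 - 2 * noiseSensitivity (gibbs G J B) (glauber G J B) t (halfspace w) := by
  let f : WeightedFun (gibbs G J B) := signForm w
  have hf : ∀ σ, f σ = signForm w σ := fun _ => rfl
  have hf1 : ‖f‖ = 1 := by
    have h : inner ℝ f f = 1 := by
      rw [weightedFun_inner]
      simp only [hf, signForm_mul_self, mul_one, sum_gibbs]
    rw [real_inner_self_eq_norm_sq] at h
    exact (pow_eq_one_iff_of_nonneg (norm_nonneg _) two_ne_zero).1 h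
  rw [one_sub_two_mul_noiseSensitivity G J B hn t w f hf]
  refine rpow_le_inner_lazyDynamics hn G hG fluctuation_isSymmetricProjection
    (fun i j hij => fluctuation_commute (gibbs_pos G J B) fun hne =>
      nonInteracting_gibbs G J B hne hij) hf1 (fun l hnd hl => ?_) ht
  exact inner_sub_dampProd_signForm_le (sum_gibbs G J B) (by unfold blockCount; positivity) hnd
    (fun i hi j hj hne => nonInteracting_gibbs G J B hne (hl i hi j hj)) w f hf

end Gibbs

end

end IsingGlauber

theorem proposition1 (Δ : ℕ) :
    ∃ β₀ : ℝ, 0 < β₀ ∧ ∃ δ : ℝ, 0 < δ ∧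
      ∀ (n : ℕ) (_hn : 1 ≤ n) (G : SimpleGraph (Fin n)) [DecidableRel G.Adj]
        (_hG : ∀ i : Fin n, G.degree i ≤ Δ)
        (J : Sym2 (Fin n) → ℝ) (_hJ : ∀ e ∈ G.edgeSet, |J e| < β₀)
        (B : ℝ) (w : Fin n → ℝ) (t : ℕ) (_ht : n ≤ t),
        δ ^ ((t : ℝ) / (n : ℝ)) ≤
          1 - 2 * IsingGlauber.noiseSensitivity (IsingGlauber.gibbs G J B)
            (IsingGlauber.glauber G J B) t (IsingGlauber.halfspace w) :=
  ⟨1, one_pos, (1 / 2) ^ (4 * IsingGlauber.stepBound Δ), by positivity,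
    fun _ hn G _ hG J _ B w _ ht => IsingGlauber.halfspace_noise_stability G J B hn hG w ht⟩
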